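/- All digraphs are finite and loopless, and directed paths are vertex-simple. An instance $I=(G=(V,E),s,t,\mathcal F)$ of Path Avoiding Forbidden Pairs (PAFP) consists of a digraph $G$, vertices $s\neq t$ of $G$ and an arbitrary set $\mathcal F\subseteq\binom V2$ of forbidden pairs; the question is whether $G$ has a directed $s$-$t$ path that contains at most one endpoint of every pair in $\mathcal F$. Write $|I|$ for the size of the instance, that is, $|V|+|E|+|\mathcal F|$ (up to a polynomial, the length of its description). Let $\operatorname{dist}_G(s,v)\in\mathbb Z_{\ge 0}\cup\{\infty\}$ be the length of a shortest directed $s$-$v$ path, let $\operatorname{bfsw}(G,s)=\max_{d\ge 0}|\{v\in V:\operatorname{dist}_G(s,v)=d\}|$ be the BFS-width of $G$ from $s$, and let $$B^-_G(s)=\{(u,v)\in E:\ \operatorname{dist}_G(s,v)<\operatorname{dist}_G(s,u)<\infty\}$$ be the set of $s$-backward arcs of $G$. **Theorem.** There is an algorithm (a single random access machine program) that decides every PAFP instance $I=(G,s,t,\mathcal F)$ in which $G$ is a DAG with $\operatorname{bfsw}(G,s)\le 2$ in time $2^{k}\cdot|I|^{O(1)}$, where $k=|B^-_G(s)|$. In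 particular, for every fixed $k$, PAFP is decidable in polynomial time on the instances in which $G$ is a DAG, $\operatorname{bfsw}(G,s)\le 2$ and $|B^-_G(s)|\le k$. -/

import Mathlib

universe u

/-! ### Directed graphs, distances, BFS layers, backward arcs -/

/-- `p` is the vertex sequence of a directed (vertex-simple) path from `u` to `v`. -/
structure IsDirPath {V : Type*} (G : Digraph V) (u v : V) (p : List V) : Prop where
  chain : p.IsChain G.Adj
  nodup : p.Nodup
  head : p.head? = some u
  last : p.getLast? = some v

/-- Length of a shortest directed path from `u` to `v`, and `⊤` if there is none.
A path with vertex sequence `p` has `p.length - 1` arcs. -/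
noncomputable def dirDist {V : Type*} (G : Digraph V) (u v : V) : ℕ∞ :=
  ⨅ (p : List V) (_ : IsDirPath G u v p), ((p.length - 1 : ℕ) : ℕ∞)

/-- The directed BFS layer at distance `d` from `s`. -/
def bfsLayer {V : Type*} (G : Digraph V) (s : V) (d : ℕ) : Set V :=
  {v | dirDist G s v = d}

/-- The BFS-width from `s`: the maximum size of a BFS layer. -/
noncomputable def bfsWidth {V : Type*} (G : Digraph V) (s : V) : ℕ∞ :=
  ⨆ d : ℕ, (bfsLayer G s d).encard

/-- A digraph is acyclic if it has no directed closed walk of positive length. -/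
def IsDAG {V : Type*} (G : Digraph V) : Prop :=
  ∀ v, ¬ Relation.TransGen G.Adj v v

/-- The set of arcs of a digraph. -/
def arcSet {V : Type*} (G : Digraph V) : Set (V × V) :=
  {a | G.Adj a.1 a.2}

/-- The `s`-backward arcs: both ends are reachable from `s`, and the head is strictly
closer to `s` than the tail. -/
def backwardArcs {V : Type*} (G : Digraph V) (s : V) : Set (V × V) :=
  {a | a ∈ arcSet G ∧ dirDist G s a.1 < ⊤ ∧ dirDist G s a.2 < ⊤ ∧
    dirDist G s a.2 < dirDist G s a.1}

/-! ### The problem Path Avoiding Forbidden Pairs -/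

/-- An instance of Path Avoiding Forbidden Pairs with vertex set `V`. -/
structure PAFPInstance (V : Type*) where
  G : Digraph V
  loopless : ∀ v, ¬ G.Adj v v
  s : V
  t : V
  s_ne_t : s ≠ t
  /-- the forbidden pairs: a set of unordered pairs of distinct vertices -/
  F : Set (Sym2 V)
  F_not_diag : ∀ q ∈ F, ¬ q.IsDiag

namespace PAFPInstance

/-- There is a directed `s`-`t` path that contains at most one endpoint of every forbidden pair. -/
def HasSafePath {V : Type*} (I : PAFPInstance V) : Prop :=
  ∃ p : List V, IsDirPath I.G I.s I.t p ∧
    ∀ a b : V, s(a, b) ∈ I.F → ¬ (a ∈ p ∧ b ∈ p)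

/-- The size `|I|`: number of vertices plus number of arcs plus number of forbidden pairs. -/
noncomputable def size {V : Type*} (I : PAFPInstance V) : ℕ :=
  Nat.card V + (arcSet I.G).ncard + I.F.ncard

/-- The number of `s`-backward input arcs. -/
noncomputable def numBackward {V : Type*} (I : PAFPInstance V) : ℕ :=
  (backwardArcs I.G I.s).ncard

/-- The list of numbers `w` is a description of `I`: for some numbering `e` of the vertices by
`0, …, n - 1`, some ordering of the arcs and some ordering of the forbidden pairs (and of the
two vertices in each of them), it reads
`n, s, t, (number of arcs), tail, head, tail, head, …, (number of pairs), a, b, a, b, …`. -/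
def IsEncoding {V : Type*} (I : PAFPInstance V) (w : List ℕ) : Prop :=
  ∃ (e : V ≃ Fin (Nat.card V)) (arcs pairs : List (V × V)),
    arcs.Nodup ∧ (∀ a, a ∈ arcs ↔ a ∈ arcSet I.G) ∧
    (pairs.map fun q => s(q.1, q.2)).Nodup ∧
    (∀ q, q ∈ (pairs.map fun q => s(q.1, q.2)) ↔ q ∈ I.F) ∧
    w = [Nat.card V, (e I.s : ℕ), (e I.t : ℕ), arcs.length]
        ++ arcs.flatMap (fun a => [(e a.1 : ℕ), (e a.2 : ℕ)])
        ++ [pairs.length]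
        ++ pairs.flatMap (fun a => [(e a.1 : ℕ), (e a.2 : ℕ)])

end PAFPInstance

/-! ### Random access machines

A random access machine with registers and integer-indexed arrays (a program refers to only
finitely many of each), in structured form: the control flow is given by sequencing, branching
and loops.  Arithmetic is restricted to successor and predecessor, so a number held by the
machine exceeds the numbers in its input and program by at most the number of steps made;
each instruction and each test is charged one step. -/

namespace RAM

/-- Tests on registers. -/
inductive Test
  | lt (x y : ℕ)
  | eq (x y : ℕ)

/-- Programs. The arguments `x y i` are names of registers, `a` is the name of an array. -/
inductive Prog
  /-- do nothing -/
  | skip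
  /-- register `x` := the constant `c` -/
  | const (x c : ℕ)
  /-- register `x` := register `y` -/
  | copy (x y : ℕ)
  /-- register `x` := register `x` plus one -/
  | succ (x : ℕ)
  /-- register `x` := register `x` minus one (zero stays zero) -/
  | pred (x : ℕ)
  /-- register `x` := entry of the array `a` whose index is held by register `i` -/
  | load (x a i : ℕ)
  /-- entry of the array `a` whose index is held by register `i` := register `x` -/
  | store (a i x : ℕ)
  | seq (p q : Prog)
  | cond (b : Test) (p q : Prog)
  | loop (b : Test) (p : Prog)

/-- The content of the registers and of the arrays. -/
structure State where
  reg : ℕ → ℕ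
  arr : ℕ → ℕ → ℕ

def State.setReg (σ : State) (x v : ℕ) : State :=
  { σ with reg := Function.update σ.reg x v }

def State.setArr (σ : State) (a i v : ℕ) : State :=
  { σ with arr := Function.update σ.arr a (Function.update (σ.arr a) i v) }

def Test.Holds (σ : State) : Test → Prop
  | .lt x y => σ.reg x < σ.reg y
  | .eq x y => σ.reg x = σ.reg y

/-- `Runs p σ T τ`: the program `p`, started in the state `σ`, halts after exactly `T` steps in
the state `τ`. -/
inductive Runs : Prog → State → ℕ → State → Prop
  | skip (σ : State) : Runs .skip σ 1 σ
  | const (σ : State) (x c : ℕ) : Runs (.const x c) σ 1 (σ.setReg x c)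
  | copy (σ : State) (x y : ℕ) : Runs (.copy x y) σ 1 (σ.setReg x (σ.reg y))
  | succ (σ : State) (x : ℕ) : Runs (.succ x) σ 1 (σ.setReg x (σ.reg x + 1))
  | pred (σ : State) (x : ℕ) : Runs (.pred x) σ 1 (σ.setReg x (σ.reg x - 1))
  | load (σ : State) (x a i : ℕ) : Runs (.load x a i) σ 1 (σ.setReg x (σ.arr a (σ.reg i)))
  | store (σ : State) (a i x : ℕ) : Runs (.store a i x) σ 1 (σ.setArr a (σ.reg i) (σ.reg x))
  | seq {p q : Prog} {σ τ υ : State} {T U : ℕ} :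
      Runs p σ T τ → Runs q τ U υ → Runs (.seq p q) σ (T + U) υ
  | cond_true {b : Test} {p q : Prog} {σ τ : State} {T : ℕ} :
      b.Holds σ → Runs p σ T τ → Runs (.cond b p q) σ (T + 1) τ
  | cond_false {b : Test} {p q : Prog} {σ τ : State} {T : ℕ} :
      ¬ b.Holds σ → Runs q σ T τ → Runs (.cond b p q) σ (T + 1) τ
  | loop_false {b : Test} {p : Prog} {σ : State} :
      ¬ b.Holds σ → Runs (.loop b p) σ 1 σ
  | loop_true {b : Test} {p : Prog} {σ τ υ : State} {T U : ℕ} :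
      b.Holds σ → Runs p σ T τ → Runs (.loop b p) τ U υ → Runs (.loop b p) σ (T + U + 1) υ

/-- The machine is deterministic: running time and final state are unique. -/
theorem Runs.deterministic {p : Prog} {σ τ τ' : State} {T T' : ℕ}
    (h : Runs p σ T τ) (h' : Runs p σ T' τ') : T = T' ∧ τ = τ' := by
  induction h generalizing T' τ' with
  | skip | const | copy | succ | pred | load | store => cases h'; exact ⟨rfl, rfl⟩
  | seq _ _ ih₁ ih₂ =>
    cases h' with
    | seq k₁ k₂ =>
      obtain ⟨rfl, rfl⟩ := ih₁ k₁
      obtain ⟨rfl, rfl⟩ := ih₂ k₂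
      exact ⟨rfl, rfl⟩
  | cond_true hb _ ih =>
    cases h' with
    | cond_true _ k => obtain ⟨rfl, rfl⟩ := ih k; exact ⟨rfl, rfl⟩
    | cond_false hb' _ => exact absurd hb hb'
  | cond_false hb _ ih =>
    cases h' with
    | cond_true hb' _ => exact absurd hb' hb
    | cond_false _ k => obtain ⟨rfl, rfl⟩ := ih k; exact ⟨rfl, rfl⟩
  | loop_false hb =>
    cases h' with
    | loop_false _ => exact ⟨rfl, rfl⟩
    | loop_true hb' _ _ => exact absurd hb' hb
  | loop_true hb _ _ ih₁ ih₂ =>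
    cases h' with
    | loop_false hb' => exact absurd hb hb'
    | loop_true _ k₁ k₂ =>
      obtain ⟨rfl, rfl⟩ := ih₁ k₁
      obtain ⟨rfl, rfl⟩ := ih₂ k₂
      exact ⟨rfl, rfl⟩

/-- The initial state: the input word is in array `0`, everything else is zero. -/
def initState (w : List ℕ) : State where
  reg := fun _ => 0
  arr := fun a i => if a = 0 then w.getD i 0 else 0

/-- On the input word `w` the program halts within `B` steps, and then register `0` holds `1`
if the answer is yes and `0` if the answer is no. -/
def DecidesWithin (p : Prog) (w : List ℕ) (answer : Prop) (B : ℕ) : Prop :=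
  ∃ (T : ℕ) (τ : State), T ≤ B ∧ Runs p (initState w) T τ ∧
    (answer → τ.reg 0 = 1) ∧ (¬ answer → τ.reg 0 = 0)

end RAM

/-! An arc between reachable vertices raises the BFS level by at most one. Hence an `s`-`t` path
visits every level up to its highest level `D`, and it descends only along backward arcs. The
algorithm guesses the set of backward arcs used by the path (`2 ^ k` choices) and `D` (at most `n`
choices). What remains is an instance of 2-SAT with one variable per vertex, saying that the vertex
is selected.

The condition that a selected vertex `v` other than `t` has a selected out-neighbour would naturally
be a long clause; width two cuts it down to two literals. If `v` sends arcs to the whole next level,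
and that level is at most `D`, the clause "the next level is visited" already supplies an
out-neighbour. Otherwise `v` has at most one out-neighbour in the next level and at most one, its
mate, in its own level. If both exist and `v` lies below level `D`, the literal `¬ x v` may be
dropped: a path that misses the mate must leave this level upwards from `v`. On level `D` only the
mate is left as an out-neighbour. A vertex with a guessed backward arc needs no such clause, because
the head of that arc is forced to be selected.

Conversely, take any satisfying assignment, for any guess. Every selected reachable vertex other
than `t` has a selected out-neighbour; following these from `s` must stop since the digraph is
acyclic, and it can stop only at `t`. The pair clauses make the path safe. The path need not match
the guess. The two directions are `Tables.Correct.exists_clauses` and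
`Tables.Correct.safe_of_clauses`.

Satisfiability is decided by the implication digraph (`exists_assignment_iff`), with reachability
computed by Bellman-Ford relaxation. The remainder realises this on the machine, in a program logic
`Wp` that carries step bounds; `search_spec`, `analyse_spec` and `decidePAFP_spec` assemble the
pieces. -/

namespace RAM

/-! ### Program logic with running times -/

namespace Prog

/-- Whether register `x` is a possible target of an assignment in the program. -/
def wr : Prog → ℕ → Bool
  | .skip, _ => false
  | .const y _, x => x == y
  | .copy y _, x => x == y
  | .succ y, x => x == y
  | .pred y, x => x == y
  | .load y _ _, x => x == y
  | .store _ _ _, _ => false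
  | .seq p q, x => p.wr x || q.wr x
  | .cond _ p q, x => p.wr x || q.wr x
  | .loop _ p, x => p.wr x

/-- Whether array `a` is a possible target of an assignment in the program. -/
def wa : Prog → ℕ → Bool
  | .store b _ _, a => a == b
  | .seq p q, a => p.wa a || q.wa a
  | .cond _ p q, a => p.wa a || q.wa a
  | .loop _ p, a => p.wa a
  | _, _ => false

/-- Sequential composition of a list of programs. -/
def block : List Prog → Prog
  | [] => .skip
  | [p] => p
  | p :: q :: l => .seq p (block (q :: l))

/-- `for i := 0, …, b - 1 do p`, where `i` and `b` are registers. -/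
def forLoop (i b : ℕ) (p : Prog) : Prog :=
  .seq (.const i 0) (.loop (.lt i b) (.seq p (.succ i)))

end Prog

/-- The states agree on everything the program `p` does not write to. -/
def Frame (p : Prog) (σ τ : State) : Prop :=
  (∀ x, p.wr x = false → τ.reg x = σ.reg x) ∧ (∀ a, p.wa a = false → τ.arr a = σ.arr a)

/-- For a concrete program and register the side condition is settled by computation, so unchanged
cells are recovered without further argument. -/
theorem Frame.reg {p : Prog} {σ τ : State} (h : Frame p σ τ) (x : ℕ)
    (hx : p.wr x = false := by rfl) : τ.reg x = σ.reg x := h.1 x hx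

theorem Frame.arr {p : Prog} {σ τ : State} (h : Frame p σ τ) (x : ℕ)
    (hx : p.wa x = false := by rfl) : τ.arr x = σ.arr x := h.2 x hx

theorem Frame.refl (p : Prog) (σ : State) : Frame p σ σ := ⟨fun _ _ => rfl, fun _ _ => rfl⟩

theorem Frame.trans {p : Prog} {σ τ υ : State} (h : Frame p σ τ) (k : Frame p τ υ) :
    Frame p σ υ :=
  ⟨fun x hx => (k.1 x hx).trans (h.1 x hx), fun x hx => (k.2 x hx).trans (h.2 x hx)⟩

theorem Frame.mono {p q : Prog} {σ τ : State} (h : Frame p σ τ)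
    (hr : ∀ x, q.wr x = false → p.wr x = false) (ha : ∀ x, q.wa x = false → p.wa x = false) :
    Frame q σ τ :=
  ⟨fun x hx => h.1 x (hr x hx), fun x hx => h.2 x (ha x hx)⟩

theorem State.setReg_reg (σ : State) (x v y : ℕ) :
    (σ.setReg x v).reg y = if y = x then v else σ.reg y := by
  simp [State.setReg, Function.update_apply]

@[simp] theorem State.setReg_arr (σ : State) (x v : ℕ) : (σ.setReg x v).arr = σ.arr := rfl

@[simp] theorem State.setArr_reg (σ : State) (a i v : ℕ) : (σ.setArr a i v).reg = σ.reg := rfl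

theorem State.setArr_arr (σ : State) (a i v b : ℕ) :
    (σ.setArr a i v).arr b = if b = a then Function.update (σ.arr a) i v else σ.arr b := by
  by_cases h : b = a
  · subst h; simp [State.setArr]
  · simp [State.setArr, h]

/-- Thanks to this, invariants and specifications have to mention only what a program changes. -/
theorem Runs.frame {p : Prog} {σ τ : State} {T : ℕ} (h : Runs p σ T τ) : Frame p σ τ := by
  induction h with
  | skip => exact Frame.refl _ _
  | const | copy | succ | pred | load =>
    refine ⟨fun x hx => ?_, fun x _ => rfl⟩
    simp only [Prog.wr, beq_eq_false_iff_ne] at hx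
    simp [State.setReg_reg, hx]
  | store =>
    refine ⟨fun x hx => rfl, fun x hx => ?_⟩
    simp only [Prog.wa, beq_eq_false_iff_ne] at hx
    simp [State.setArr_arr, hx]
  | seq _ _ ih₁ ih₂ =>
    refine (ih₁.mono ?_ ?_).trans (ih₂.mono ?_ ?_) <;> simp +contextual [Prog.wr, Prog.wa]
  | cond_true _ _ ih | cond_false _ _ ih =>
    refine ih.mono ?_ ?_ <;> simp +contextual [Prog.wr, Prog.wa]
  | loop_false => exact Frame.refl _ _
  | loop_true _ _ _ ih₁ ih₂ =>
    exact (ih₁.mono (fun _ h => h) (fun _ h => h)).trans ih₂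

/-- Started in `σ`, the program halts within `B` steps in a state that satisfies `Q`. -/
def Wp (p : Prog) (B : ℕ) (σ : State) (Q : State → Prop) : Prop :=
  ∃ T τ, T ≤ B ∧ Runs p σ T τ ∧ Q τ

namespace Wp

/-- The frame of the run is handed to the weakening step, so facts about untouched cells need not be
part of `Q`. -/
theorem mono {p : Prog} {B B' : ℕ} {σ : State} {Q Q' : State → Prop} (h : Wp p B σ Q)
    (hB : B ≤ B') (hQ : ∀ τ, Frame p σ τ → Q τ → Q' τ) : Wp p B' σ Q' := by
  obtain ⟨T, τ, hT, hr, hq⟩ := h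
  exact ⟨T, τ, hT.trans hB, hr, hQ τ hr.frame hq⟩

theorem seq {p q : Prog} {B C : ℕ} {σ : State} {Q R : State → Prop} (h : Wp p B σ Q)
    (h' : ∀ τ, Frame p σ τ → Q τ → Wp q C τ R) : Wp (.seq p q) (B + C) σ R := by
  obtain ⟨T, τ, hT, hr, hq⟩ := h
  obtain ⟨U, υ, hU, hr', hq'⟩ := h' τ hr.frame hq
  exact ⟨T + U, υ, Nat.add_le_add hT hU, hr.seq hr', hq'⟩

theorem cond {b : Test} {p q : Prog} {B : ℕ} {σ : State} {Q : State → Prop}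
    (h : b.Holds σ → Wp p B σ Q) (h' : ¬ b.Holds σ → Wp q B σ Q) :
    Wp (.cond b p q) (B + 1) σ Q := by
  by_cases hb : b.Holds σ
  · obtain ⟨T, τ, hT, hr, hq⟩ := h hb
    exact ⟨T + 1, τ, by omega, hr.cond_true hb, hq⟩
  · obtain ⟨T, τ, hT, hr, hq⟩ := h' hb
    exact ⟨T + 1, τ, by omega, hr.cond_false hb, hq⟩

/-- Total correctness for a loop known to make exactly `N` passes: each pass pays for its test and
the body, and the last, failing test costs one more step. -/
theorem loop {b : Test} {p : Prog} {B N : ℕ} {σ : State} (Inv : ℕ → State → Prop)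
    (h0 : Inv 0 σ)
    (step : ∀ j < N, ∀ τ, Frame p σ τ → Inv j τ → b.Holds τ ∧ Wp p B τ (Inv (j + 1)))
    (hexit : ∀ τ, Frame p σ τ → Inv N τ → ¬ b.Holds τ) :
    Wp (.loop b p) (1 + N * (B + 1)) σ (Inv N) := by
  -- The induction is on the number `i` of passes still to come, so the invariant has index `N - i`.
  have key : ∀ i ≤ N, ∀ τ, Frame p σ τ → Inv (N - i) τ →
      Wp (.loop b p) (1 + i * (B + 1)) τ (Inv N) := by
    intro i
    induction i with
    | zero => exact fun _ τ hf h => ⟨1, τ, by simp, .loop_false (hexit τ hf h), h⟩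
    | succ i ih =>
      intro hi τ hf h
      obtain ⟨hb, T, υ, hT, hr, hq⟩ := step (N - (i + 1)) (by omega) τ hf h
      have e : N - (i + 1) + 1 = N - i := by omega
      rw [e] at hq
      obtain ⟨U, ρ, hU, hr', hq'⟩ := ih (by omega) υ (hf.trans hr.frame) hq
      exact ⟨T + U + 1, ρ, by rw [Nat.succ_mul]; omega, .loop_true hb hr hr', hq'⟩
  exact key N le_rfl σ (Frame.refl _ _) (by simpa using h0)

/-- The increment of the counter is built into the postcondition required of the body, so only the
body has to be analysed. Each pass costs test, body and increment; the initialisation and the last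
test give the 2. -/
theorem forLoop {i b : ℕ} {p : Prog} {B N : ℕ} {σ : State} (Inv : ℕ → State → Prop)
    (hN : σ.reg b = N) (hi : p.wr i = false) (hb : p.wr b = false) (hib : b ≠ i)
    (h0 : Inv 0 (σ.setReg i 0))
    (step : ∀ j < N, ∀ τ, Frame (Prog.forLoop i b p) σ τ → τ.reg i = j → Inv j τ →
      Wp p B τ fun υ => Inv (j + 1) (υ.setReg i (j + 1))) :
    Wp (Prog.forLoop i b p) (2 + N * (B + 2)) σ (Inv N) := by
  have e : 2 + N * (B + 2) = 1 + (1 + N * ((B + 1) + 1)) := by ring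
  rw [e]
  refine Wp.seq (Q := fun τ => τ = σ.setReg i 0) ⟨1, _, le_rfl, .const _ _ _, rfl⟩ ?_
  rintro τ hf rfl
  have hmono : ∀ τ, Frame (.seq p (.succ i)) (σ.setReg i 0) τ → Frame (Prog.forLoop i b p) σ τ := by
    intro τ h
    refine (Frame.mono hf ?_ ?_).trans (h.mono ?_ ?_) <;>
      simp +contextual [Prog.wr, Prog.wa, Prog.forLoop]
  refine (Wp.loop (fun j τ => τ.reg i = j ∧ Inv j τ) ⟨by simp [State.setReg_reg], h0⟩ ?_ ?_).mono
    le_rfl (fun τ _ h => h.2)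
  · rintro j hj τ hτ ⟨hij, hinv⟩
    have hτ' := hmono τ hτ
    have hbN : τ.reg b = N := by
      rw [hτ'.reg b (by simp [Prog.wr, Prog.forLoop, hb, hib]), hN]
    refine ⟨by simp [Test.Holds, hbN, hij, hj], ?_⟩
    refine Wp.seq (step j hj τ hτ' hij hinv) ?_
    intro υ hυ hq
    have : υ.reg i = j := (hυ.reg i hi).trans hij
    refine ⟨1, _, le_rfl, .succ _ _, ?_, ?_⟩
    · simp [State.setReg_reg, this]
    · rw [this]; exact hq
  · rintro τ hτ ⟨hij, -⟩
    have hbN : τ.reg b = N := by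
      rw [(hmono τ hτ).reg b (by simp [Prog.wr, Prog.forLoop, hb, hib]), hN]
    simp [Test.Holds, hij, hbN]

end Wp

/-! ### Loop-free programs -/

instance (σ : State) (b : Test) : Decidable (b.Holds σ) := by
  cases b <;> unfold Test.Holds <;> infer_instance

namespace Prog

/-- The effect of a loop-free program. -/
def eval : Prog → State → State
  | .skip, σ => σ
  | .const x c, σ => σ.setReg x c
  | .copy x y, σ => σ.setReg x (σ.reg y)
  | .succ x, σ => σ.setReg x (σ.reg x + 1)
  | .pred x, σ => σ.setReg x (σ.reg x - 1)
  | .load x a i, σ => σ.setReg x (σ.arr a (σ.reg i))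
  | .store a i x, σ => σ.setArr a (σ.reg i) (σ.reg x)
  | .seq p q, σ => q.eval (p.eval σ)
  | .cond b p q, σ => if b.Holds σ then p.eval σ else q.eval σ
  -- A junk value: `loopFree` excludes loops wherever `eval` is used for a specification.
  | .loop _ _, σ => σ

/-- Whether the program is free of loops. -/
def loopFree : Prog → Bool
  | .seq p q => p.loopFree && q.loopFree
  | .cond _ p q => p.loopFree && q.loopFree
  | .loop _ _ => false
  | _ => true

/-- A bound on the running time of a loop-free program. -/
def cost : Prog → ℕ
  | .seq p q => p.cost + q.cost
  | .cond _ p q => p.cost + q.cost + 1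
  | .loop _ _ => 0
  | _ => 1

end Prog

/-- Straight-line code is verified by simplifying `eval`; both branches of a conditional are
charged, which keeps the bound independent of the state. -/
theorem Wp.of_loopFree {p : Prog} {σ : State} {Q : State → Prop} (hp : p.loopFree = true)
    (h : Q (p.eval σ)) : Wp p p.cost σ Q := by
  have key : ∃ T ≤ p.cost, Runs p σ T (p.eval σ) := by
    clear h
    induction p generalizing σ with
    | skip => exact ⟨1, le_rfl, .skip _⟩
    | const => exact ⟨1, le_rfl, .const _ _ _⟩
    | copy => exact ⟨1, le_rfl, .copy _ _ _⟩
    | succ => exact ⟨1, le_rfl, .succ _ _⟩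
    | pred => exact ⟨1, le_rfl, .pred _ _⟩
    | load => exact ⟨1, le_rfl, .load _ _ _ _⟩
    | store => exact ⟨1, le_rfl, .store _ _ _ _⟩
    | seq p q ihp ihq =>
      simp only [Prog.loopFree, Bool.and_eq_true] at hp
      obtain ⟨T, hT, hr⟩ := ihp (σ := σ) hp.1
      obtain ⟨U, hU, hr'⟩ := ihq (σ := p.eval σ) hp.2
      exact ⟨T + U, Nat.add_le_add hT hU, hr.seq hr'⟩
    | cond b p q ihp ihq =>
      simp only [Prog.loopFree, Bool.and_eq_true] at hp
      by_cases hb : b.Holds σ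
      · obtain ⟨T, hT, hr⟩ := ihp (σ := σ) hp.1
        refine ⟨T + 1, by simp only [Prog.cost]; omega, ?_⟩
        simp only [Prog.eval, hb, if_true]
        exact hr.cond_true hb
      · obtain ⟨T, hT, hr⟩ := ihq (σ := σ) hp.2
        refine ⟨T + 1, by simp only [Prog.cost]; omega, ?_⟩
        simp only [Prog.eval, hb, if_false]
        exact hr.cond_false hb
    | loop => simp [Prog.loopFree] at hp
  obtain ⟨T, hT, hr⟩ := key
  exact ⟨T, _, hT, hr, h⟩

/-- The bound used for nested loops over ranges of polynomial size. -/
theorem loop_bound {Z N B C e : ℕ} (hZ : 1 ≤ Z) (hN : N ≤ Z) (hB : B ≤ C * Z ^ e) :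
    2 + N * (B + 2) ≤ (C + 4) * Z ^ (e + 1) := by
  have h1 : 1 ≤ Z ^ e := Nat.one_le_pow _ _ hZ
  calc 2 + N * (B + 2) ≤ 2 * (Z * Z ^ e) + Z * (C * Z ^ e + 2 * Z ^ e) := by
        gcongr
        · nlinarith
        · omega
    _ = (C + 4) * Z ^ (e + 1) := by ring

end RAM

/-! ### Walks of a given length and shortest paths -/

/-- There is a walk with `k` steps from `s` to the given vertex. -/
def WalkFrom {α : Type*} (r : α → α → Prop) (s : α) : ℕ → α → Prop
  | 0, v => v = s
  | k + 1, v => ∃ u, WalkFrom r s k u ∧ r u v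

theorem WalkFrom.reflTransGen {α : Type*} {r : α → α → Prop} {s : α} {k : ℕ} {v : α}
    (h : WalkFrom r s k v) : Relation.ReflTransGen r s v := by
  induction k generalizing v with
  | zero => cases h; exact .refl
  | succ k ih => obtain ⟨u, hu, huv⟩ := h; exact (ih hu).tail huv

theorem exists_walkFrom {α : Type*} {r : α → α → Prop} {s v : α}
    (h : Relation.ReflTransGen r s v) : ∃ k, WalkFrom r s k v := by
  induction h with
  | refl => exact ⟨0, rfl⟩
  | tail _ hbc ih => obtain ⟨k, hk⟩ := ih; exact ⟨k + 1, _, hk, hbc⟩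

theorem WalkFrom.append_chain {α : Type*} {r : α → α → Prop} {s : α} {p : List α} {a b : α}
    {k : ℕ} (hk : WalkFrom r s k a) (hc : p.IsChain r) (hh : p.head? = some a)
    (hl : p.getLast? = some b) : WalkFrom r s (k + (p.length - 1)) b := by
  induction p generalizing a k with
  | nil => simp at hh
  | cons x l ih =>
    cases l with
    | nil => simp_all
    | cons y l =>
      simp only [List.head?_cons, Option.some.injEq] at hh
      subst hh
      rw [List.isChain_cons_cons] at hc
      have := ih (a := y) (k := k + 1) ⟨_, hk, hc.1⟩ hc.2 rfl (by simpa using hl)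
      simp only [List.length_cons] at this ⊢
      convert this using 1
      omega

theorem IsDirPath.walkFrom {α : Type*} {G : Digraph α} {u v : α} {p : List α}
    (h : IsDirPath G u v p) : WalkFrom G.Adj u (p.length - 1) v := by
  have := WalkFrom.append_chain (s := u) (k := 0) rfl h.chain h.head h.last
  simpa using this

/-- If the new end vertex already lies on the path, the path is cut there; otherwise the vertex is
appended. -/
theorem WalkFrom.exists_isDirPath {α : Type*} {G : Digraph α} {s : α} {k : ℕ} {v : α}
    (h : WalkFrom G.Adj s k v) : ∃ p, IsDirPath G s v p ∧ p.length ≤ k + 1 := by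
  induction k generalizing v with
  | zero => cases h; exact ⟨[s], ⟨by simp, by simp, rfl, rfl⟩, by simp⟩
  | succ k ih =>
    obtain ⟨u, hu, huv⟩ := h
    obtain ⟨p, hp, hlen⟩ := ih hu
    by_cases hv : v ∈ p
    · obtain ⟨l₁, l₂, rfl⟩ := List.append_of_mem hv
      have hpre : l₁ ++ [v] <+: l₁ ++ v :: l₂ := ⟨l₂, by simp⟩
      refine ⟨l₁ ++ [v], ⟨hp.chain.prefix hpre, hp.nodup.sublist hpre.sublist, ?_, by simp⟩, ?_⟩
      · have := hp.head
        cases l₁ <;> simpa using this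
      · have := hpre.length_le
        omega
    · refine ⟨p ++ [v], ⟨?_, ?_, ?_, by simp⟩, by simp; omega⟩
      · rw [List.isChain_append]
        refine ⟨hp.chain, by simp, ?_⟩
        intro x hx y hy
        rw [hp.last] at hx
        simp only [Option.mem_def, Option.some.injEq, List.head?_cons] at hx hy
        subst hx hy; exact huv
      · rw [List.nodup_append]
        refine ⟨hp.nodup, by simp, ?_⟩
        intro a ha b hb
        simp only [List.mem_singleton] at hb
        rintro rfl
        exact hv (hb ▸ ha)
      · rw [List.head?_append, hp.head]; rfl

/-- Distances are defined by simple paths, whereas relaxation produces walks; shortening walks to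
paths shows that the minima agree. -/
theorem dirDist_eq_of_walk {α : Type*} {G : Digraph α} {s v : α} {d : ℕ}
    (h : WalkFrom G.Adj s d v) (hmin : ∀ k, WalkFrom G.Adj s k v → d ≤ k) :
    dirDist G s v = d := by
  apply le_antisymm
  · obtain ⟨p, hp, hlen⟩ := h.exists_isDirPath
    refine (iInf₂_le p hp).trans ?_
    exact_mod_cast (by omega : p.length - 1 ≤ d)
  · refine le_iInf₂ fun p hp => ?_
    exact_mod_cast hmin _ hp.walkFrom

/-- Walks among finitely many vertices can be made short. -/
theorem WalkFrom.exists_lt {r : ℕ → ℕ → Prop} {N s k v : ℕ} (hs : s < N)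
    (hr : ∀ a b, r a b → b < N) (h : WalkFrom r s k v) :
    ∃ k' < N, WalkFrom r s k' v := by
  obtain ⟨p, hp, -⟩ := WalkFrom.exists_isDirPath (G := ⟨r⟩) h
  refine ⟨p.length - 1, ?_, hp.walkFrom⟩
  have hmem : ∀ x ∈ p, x < N := by
    have hch := hp.chain
    have hh := hp.head
    clear hp h
    induction p generalizing s with
    | nil => simp
    | cons y l ih =>
      simp only [List.head?_cons, Option.some.injEq] at hh
      subst hh
      intro x hx
      rcases List.mem_cons.1 hx with rfl | hx
      · exact hs
      · cases l with
        | nil => simp at hx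
        | cons z l =>
          rw [List.isChain_cons_cons] at hch
          exact ih (hr _ _ hch.1) hch.2 rfl x hx
  -- Pigeonhole: a simple path has at most `N` vertices, hence fewer than `N` arcs.
  have hsub : p.toFinset ⊆ Finset.range N := fun x hx => by
    simpa using hmem x (by simpa using hx)
  have := Finset.card_le_card hsub
  rw [List.toFinset_card_of_nodup hp.nodup, Finset.card_range] at this
  omega

/-- A chain of an acyclic relation has no repetitions. -/
theorem nodup_of_isChain {α : Type*} {r : α → α → Prop}
    (hr : ∀ v, ¬ Relation.TransGen r v v) {p : List α} (h : p.IsChain r) : p.Nodup := by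
  have h2 : p.IsChain (Relation.TransGen r) := h.imp fun _ _ => .single
  rw [List.isChain_iff_pairwise] at h2
  exact List.Pairwise.imp (S := (· ≠ ·)) (fun {a b} (hab : Relation.TransGen r a b) e =>
    by subst e; exact hr a hab) h2

/-! ### Satisfiability of 2-clauses -/

/-- The value of the literal `l` under `x`: literals below `n` are the variables, and `n + v` is
the negation of the variable `v`. -/
def LitHolds (n : ℕ) (x : ℕ → Prop) (l : ℕ) : Prop := if l < n then x l else ¬ x (l - n)

/-- The complementary literal. -/
def negLit (n l : ℕ) : ℕ := if l < n then n + l else l - n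

theorem negLit_lt {n l : ℕ} (h : l < 2 * n) : negLit n l < 2 * n := by
  unfold negLit; split <;> omega

theorem negLit_negLit {n l : ℕ} (h : l < 2 * n) : negLit n (negLit n l) = l := by
  unfold negLit; split <;> split <;> omega

theorem litHolds_negLit {n l : ℕ} (h : l < 2 * n) (x : ℕ → Prop) :
    LitHolds n x (negLit n l) ↔ ¬ LitHolds n x l := by
  unfold LitHolds negLit
  by_cases h1 : l < n
  · simp [h1]
  · simp [h1, show l - n < n by omega]

theorem litHolds_of_lt {n l : ℕ} (h : l < n) (x : ℕ → Prop) : LitHolds n x l ↔ x l := by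
  simp [LitHolds, h]

theorem litHolds_add {n : ℕ} (v : ℕ) (x : ℕ → Prop) : LitHolds n x (n + v) ↔ ¬ x v := by
  simp [LitHolds]

/-- A skew-symmetric system of implications between literals is satisfiable if and only if no
variable is equivalent to its negation. -/
theorem exists_assignment_iff {n : ℕ} {r : ℕ → ℕ → Prop}
    (hr : ∀ a b, r a b → a < 2 * n ∧ b < 2 * n)
    (hskew : ∀ a b, r a b → r (negLit n b) (negLit n a)) :
    (∃ x : ℕ → Prop, ∀ a b, r a b → LitHolds n x a → LitHolds n x b) ↔
      ∀ v < n, ¬ (Relation.ReflTransGen r v (n + v) ∧ Relation.ReflTransGen r (n + v) v) := by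
  constructor
  · rintro ⟨x, hx⟩ v hv ⟨h1, h2⟩
    have key : ∀ a b, Relation.ReflTransGen r a b → LitHolds n x a → LitHolds n x b := by
      intro a b h ha
      induction h with
      | refl => exact ha
      | tail _ hbc ih => exact hx _ _ hbc ih
    have k1 := key _ _ h1
    have k2 := key _ _ h2
    rw [litHolds_of_lt hv, litHolds_add] at k1 k2
    tauto
  · intro h
    -- Skew symmetry passes from single implications to chains of them.
    have hskew' : ∀ a b, a < 2 * n → Relation.ReflTransGen r a b →
        b < 2 * n ∧ Relation.ReflTransGen r (negLit n b) (negLit n a) := by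
      intro a b ha hab
      induction hab with
      | refl => exact ⟨ha, .refl⟩
      | tail _ hbc ih => exact ⟨(hr _ _ hbc).2, ih.2.head (hskew _ _ hbc)⟩
    -- `C` is the set of literals made true so far: closed under implication, free of complementary
    -- pairs, and deciding the first `j` variables.
    have key : ∀ j ≤ n, ∃ C : Set ℕ, (∀ a b, r a b → a ∈ C → b ∈ C) ∧ (∀ a ∈ C, a < 2 * n) ∧
        (∀ a ∈ C, negLit n a ∉ C) ∧ ∀ v < j, v ∈ C ∨ n + v ∈ C := by
      intro j
      induction j with
      | zero => exact fun _ => ⟨∅, by simp⟩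
      | succ j ih =>
        intro hj
        obtain ⟨C, hcl, hlt, hcons, hcov⟩ := ih (by omega)
        have hclR : ∀ a b, Relation.ReflTransGen r a b → a ∈ C → b ∈ C := by
          intro a b hab ha
          induction hab with
          | refl => exact ha
          | tail _ hbc ih => exact hcl _ _ hbc ih
        by_cases hin : j ∈ C ∨ n + j ∈ C
        · refine ⟨C, hcl, hlt, hcons, fun v hv => ?_⟩
          rcases Nat.lt_succ_iff_lt_or_eq.1 hv with hv | rfl
          · exact hcov v hv
          · exact hin
        push Not at hin
        have hneg1 : negLit n j = n + j := by simp [negLit, show j < n by omega]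
        have hneg2 : negLit n (n + j) = j := by simp [negLit]
        -- One of the two literals of `j` does not imply its complement. It is made true together
        -- with everything reachable from it.
        obtain ⟨l, hl, hl1, hl2, hl3⟩ : ∃ l, l < 2 * n ∧ (l = j ∨ l = n + j) ∧ negLit n l ∉ C ∧
            ¬ Relation.ReflTransGen r l (negLit n l) := by
          by_cases h1 : Relation.ReflTransGen r j (n + j)
          · refine ⟨n + j, by omega, .inr rfl, by rw [hneg2]; exact hin.1, ?_⟩
            rw [hneg2]
            exact fun h2 => h j (by omega) ⟨h1, h2⟩
          · exact ⟨j, by omega, .inl rfl, by rw [hneg1]; exact hin.2, by rwa [hneg1]⟩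
        refine ⟨C ∪ {a | Relation.ReflTransGen r l a}, ?_, ?_, ?_, ?_⟩
        · rintro a b hab (ha | ha)
          · exact .inl (hcl _ _ hab ha)
          · exact .inr (Relation.ReflTransGen.tail ha hab)
        · rintro a (ha | ha)
          · exact hlt a ha
          · exact (hskew' _ _ hl ha).1
        -- A complementary pair across old and new literals would, by contraposition, put the
        -- complement of `l` into `C`; a pair among the new ones would let `l` imply its own
        -- complement.
        · rintro a (ha | ha) (hb | hb)
          · exact hcons a ha hb
          · have := (hskew' _ _ hl hb).2
            rw [negLit_negLit (hlt a ha)] at this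
            exact hl2 (hclR _ _ this ha)
          · have h1 := hskew' _ _ hl ha
            exact hl2 (hclR _ _ h1.2 hb)
          · have h1 := hskew' _ _ hl ha
            have h2 := (hskew' _ _ hl hb).2
            rw [negLit_negLit h1.1] at h2
            exact hl3 (Relation.ReflTransGen.trans ha h2)
        · intro v hv
          rcases Nat.lt_succ_iff_lt_or_eq.1 hv with hv | rfl
          · exact (hcov v hv).imp .inl .inl
          · rcases hl1 with rfl | rfl
            · exact .inl (.inr .refl)
            · exact .inr (.inr .refl)
    obtain ⟨C, hcl, hlt, hcons, hcov⟩ := key n le_rfl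
    refine ⟨fun v => v ∈ C, ?_⟩
    have hC : ∀ l < 2 * n, LitHolds n (fun v => v ∈ C) l ↔ l ∈ C := by
      intro l hl
      unfold LitHolds
      by_cases h1 : l < n
      · simp [h1]
      · have h2 := hcons l
        have h3 := hcov (l - n) (by omega)
        rw [show n + (l - n) = l by omega] at h3
        simp only [negLit, h1, if_false] at h2 ⊢
        tauto
    intro a b hab ha
    rw [hC a (hr a b hab).1] at ha
    rw [hC b (hr a b hab).2]
    exact hcl a b hab ha

/-! ### Paths in digraphs of BFS-width two as solutions of 2-clauses -/

section Lists

variable {α : Type*} {r : α → α → Prop}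

theorem forall_mem_of_isChain {P : α → Prop} (hP : ∀ a b, r a b → P a → P b) {p : List α} {a : α}
    (hc : p.IsChain r) (hh : p.head? = some a) (ha : P a) : ∀ v ∈ p, P v := by
  induction p generalizing a with
  | nil => simp
  | cons y l ih =>
    simp only [List.head?_cons, Option.some.injEq] at hh
    subst hh
    intro x hx
    rcases List.mem_cons.1 hx with rfl | hx
    · exact ha
    · cases l with
      | nil => simp at hx
      | cons z l =>
        rw [List.isChain_cons_cons] at hc
        exact ih hc.2 rfl (hP _ _ hc.1 ha) x hx

theorem exists_next {p : List α} {v t : α} (hv : v ∈ p) (hl : p.getLast? = some t) (hvt : v ≠ t) :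
    ∃ w, [v, w] <:+: p := by
  obtain ⟨l₁, l₂, rfl⟩ := List.append_of_mem hv
  cases l₂ with
  | nil => simp at hl; exact absurd hl hvt
  | cons w l₂ => exact ⟨w, l₁, l₂, by simp⟩

/-- If the level rises by at most one in every step, then no level is jumped over. -/
theorem exists_crossing {δ : α → ℕ} {p : List α} {a v : α} {d : ℕ}
    (hc : p.IsChain fun a b => δ b ≤ δ a + 1) (hh : p.head? = some a) (ha : δ a ≤ d)
    (hv : v ∈ p) (hd : d < δ v) : ∃ b c, [b, c] <:+: p ∧ δ b = d ∧ δ c = d + 1 := by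
  induction p generalizing a with
  | nil => simp at hv
  | cons y l ih =>
    simp only [List.head?_cons, Option.some.injEq] at hh
    subst hh
    rcases List.mem_cons.1 hv with rfl | hv
    · omega
    · cases l with
      | nil => simp at hv
      | cons z l =>
        rw [List.isChain_cons_cons] at hc
        by_cases hz : δ z ≤ d
        · obtain ⟨b, c, hi, h⟩ := ih hc.2 rfl hz hv
          exact ⟨b, c, hi.trans (List.suffix_cons _ _).isInfix, h⟩
        -- Here the path passes from level at most `d` to level above `d`; a rise of at most one
        -- forces the levels `d` and `d + 1`.
        · exact ⟨y, z, ⟨[], l, by simp⟩, by omega, by omega⟩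

theorem rel_of_infix {p : List α} {a b : α} (hc : p.IsChain r) (h : [a, b] <:+: p) : r a b := by
  have := hc.infix h
  simpa using this

theorem exists_max_mem (δ : α → ℕ) {p : List α} (hp : p ≠ []) :
    ∃ v ∈ p, ∀ u ∈ p, δ u ≤ δ v := by
  induction p with
  | nil => exact absurd rfl hp
  | cons a l ih =>
    by_cases hl : l = []
    · subst hl; exact ⟨a, by simp⟩
    · obtain ⟨v, hv, h⟩ := ih hl
      by_cases hav : δ a ≤ δ v
      · exact ⟨v, by simp [hv], by simpa [hav] using h⟩
      · refine ⟨a, by simp, ?_⟩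
        intro u hu
        rcases List.mem_cons.1 hu with rfl | hu
        · exact le_rfl
        · have := h u hu; omega

end Lists

/-- The tables from which the clauses are made. The vertices are the numbers below `n`. -/
structure Tables where
  (n s t q k : ℕ)
  /-- levels; the level `n` stands for unreachable vertices -/
  δ : ℕ → ℕ
  /-- the other vertex of the same level, or the vertex itself -/
  mate : ℕ → ℕ
  /-- the literal of an out-neighbour in the same level, or of the negated vertex -/
  lit₁ : ℕ → ℕ
  /-- the literal of an out-neighbour in the next level, or of the negated vertex -/
  lit₂ : ℕ → ℕ
  /-- nonzero if the whole next level consists of out-neighbours -/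
  full : ℕ → ℕ
  /-- tails of the backward arcs -/
  bt : ℕ → ℕ
  /-- heads of the backward arcs -/
  bh : ℕ → ℕ
  /-- first vertices of the forbidden pairs -/
  fa : ℕ → ℕ
  /-- second vertices of the forbidden pairs -/
  fb : ℕ → ℕ

namespace Tables

/-- The tables are correct for the digraph with adjacency relation `r`. -/
structure Correct (c : Tables) (r : ℕ → ℕ → Prop) : Prop where
  s_lt : c.s < c.n
  lt : ∀ a b, r a b → a < c.n ∧ b < c.n
  acyclic : ∀ v, ¬ Relation.TransGen r v v
  δ_s : c.δ c.s = 0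
  δ_step : ∀ a b, r a b → c.δ a < c.n → c.δ b < c.n ∧ c.δ b ≤ c.δ a + 1
  -- Width two: the level of `v` consists of `v` and its mate, which coincide on a one-vertex level.
  mate_spec : ∀ v < c.n, c.δ v < c.n → c.mate v < c.n ∧ c.δ (c.mate v) = c.δ v ∧
    ∀ u < c.n, c.δ u = c.δ v → u = v ∨ u = c.mate v
  -- The default `n + v` is the literal `¬ x v`, so a missing out-neighbour turns the clause into an
  -- implication from `x v`, or into `¬ x v` itself.
  lit₁_spec : ∀ v < c.n, c.δ v < c.n → (c.lit₁ v = c.n + v ∧ ∀ w, r v w → c.δ w ≠ c.δ v) ∨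
    (r v (c.lit₁ v) ∧ c.δ (c.lit₁ v) = c.δ v)
  lit₂_spec : ∀ v < c.n, c.δ v < c.n → (c.lit₂ v = c.n + v ∧ ∀ w, r v w → c.δ w ≠ c.δ v + 1) ∨
    (r v (c.lit₂ v) ∧ c.δ (c.lit₂ v) = c.δ v + 1)
  -- If `full v` is zero, `lit₂ v` is the only candidate in the next level; otherwise `w` and its
  -- mate exhaust that level.
  full_eq : ∀ v < c.n, c.δ v < c.n → c.full v = 0 → ∀ w, r v w → c.δ w = c.δ v + 1 → w = c.lit₂ v
  full_ne : ∀ v < c.n, c.δ v < c.n → c.full v ≠ 0 →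
    ∃ w, r v w ∧ r v (c.mate w) ∧ c.δ w = c.δ v + 1
  back_rel : ∀ i < c.k, r (c.bt i) (c.bh i)
  exists_back : ∀ a b, r a b → c.δ a < c.n → c.δ b < c.δ a → ∃ i < c.k, c.bt i = a ∧ c.bh i = b
  fa_lt : ∀ i < c.q, c.fa i < c.n
  fb_lt : ∀ i < c.q, c.fb i < c.n

/-- The vertex set `x` satisfies the clauses for paths whose backward arcs are selected by `bits`
and whose highest level is `D`. -/
def Clauses (c : Tables) (bits : ℕ → Prop) (D : ℕ) (x : ℕ → Prop) : Prop :=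
  x c.s ∧ (∀ i < c.q, ¬ x (c.fa i) ∨ ¬ x (c.fb i)) ∧ (∀ i < c.k, bits i → x (c.bh i)) ∧
  ∀ v < c.n, c.δ v < c.n → (c.δ v ≤ D → x v ∨ x (c.mate v)) ∧
    -- Below level `D` the literal `¬ x v` is present only as a default value of `lit₁` or `lit₂`.
    -- From level `D` on it is explicit, since no crossing to the next level is available to justify
    -- its omission.
    (v ≠ c.t → (∀ i < c.k, bits i → c.bt i ≠ v) →
      if c.δ v < D then
        c.full v = 0 → LitHolds c.n x (c.lit₁ v) ∨ LitHolds c.n x (c.lit₂ v)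
      else LitHolds c.n x (c.lit₁ v) ∨ ¬ x v)

/-- A safe path, in terms of the tables. -/
def Safe (c : Tables) (r : ℕ → ℕ → Prop) : Prop :=
  ∃ p : List ℕ, IsDirPath ⟨r⟩ c.s c.t p ∧ ∀ i < c.q, ¬ (c.fa i ∈ p ∧ c.fb i ∈ p)

/-! ### Equivalence of safe paths and satisfiable clause systems -/

variable {c : Tables} {r : ℕ → ℕ → Prop}

/-- The clauses give each selected reachable vertex other than `t` a selected out-neighbour, and
acyclicity does the rest. Neither `bits` nor `D` has to describe the resulting path. -/
theorem Correct.safe_of_clauses (hc : c.Correct r) {bits : ℕ → Prop} {D : ℕ} {x : ℕ → Prop}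
    (hx : c.Clauses bits D x) : c.Safe r := by
  obtain ⟨hs, hF, hS, hV⟩ := hx
  have next : ∀ v < c.n, c.δ v < c.n → x v → v ≠ c.t → ∃ w, r v w ∧ x w := by
    intro v hv hδ hxv hvt
    by_cases hm : ∀ i < c.k, bits i → c.bt i ≠ v
    · have h1 : LitHolds c.n x (c.lit₁ v) → ∃ w, r v w ∧ x w := by
        intro h
        rcases hc.lit₁_spec v hv hδ with ⟨e, -⟩ | ⟨hr, -⟩
        · rw [e, litHolds_add] at h; exact absurd hxv h
        · exact ⟨_, hr, (litHolds_of_lt (hc.lt _ _ hr).2 x).1 h⟩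
      have h2 : LitHolds c.n x (c.lit₂ v) → ∃ w, r v w ∧ x w := by
        intro h
        rcases hc.lit₂_spec v hv hδ with ⟨e, -⟩ | ⟨hr, -⟩
        · rw [e, litHolds_add] at h; exact absurd hxv h
        · exact ⟨_, hr, (litHolds_of_lt (hc.lt _ _ hr).2 x).1 h⟩
      have h := (hV v hv hδ).2 hvt hm
      split at h
      · by_cases hf : c.full v = 0
        · exact (h hf).elim h1 h2
        -- The next level is at most `D`, so it has a selected vertex, and both of its vertices are
        -- out-neighbours.
        · obtain ⟨w, hw, hmw, hd⟩ := hc.full_ne v hv hδ hf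
          have hwn := (hc.lt _ _ hw).2
          rcases (hV w hwn (hc.δ_step _ _ hw hδ).1).1 (by omega) with h | h
          · exact ⟨w, hw, h⟩
          · exact ⟨_, hmw, h⟩
      · rcases h with h | h
        · exact h1 h
        · exact absurd hxv h
    · push Not at hm
      obtain ⟨i, hi, hb, rfl⟩ := hm
      exact ⟨_, hc.back_rel i hi, hS i hi hb⟩
  -- Reversed reachability is a strict order by acyclicity, hence well-founded on the finitely many
  -- vertices: the path to `t` is built by induction along it.
  have : IsStrictOrder ℕ (Relation.TransGen (Function.swap r)) :=
    { irrefl := fun a h => hc.acyclic a (Relation.transGen_swap.1 h)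
      trans := fun _ _ _ => Relation.TransGen.trans }
  have hwf := (Set.finite_Iio c.n).wellFoundedOn (r := Relation.TransGen (Function.swap r))
  have key : ∀ v < c.n, c.δ v < c.n → x v →
      ∃ p : List ℕ, p.IsChain r ∧ p.head? = some v ∧ p.getLast? = some c.t ∧ ∀ u ∈ p, x u := by
    intro v hv
    refine hwf.induction (P := fun v => c.δ v < c.n → x v → ∃ p : List ℕ, p.IsChain r ∧
      p.head? = some v ∧ p.getLast? = some c.t ∧ ∀ u ∈ p, x u) hv ?_
    intro v hv ih hδ hxv
    by_cases hvt : v = c.t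
    · exact ⟨[v], by simp, rfl, by simp [hvt], by simpa using hxv⟩
    · obtain ⟨w, hw, hxw⟩ := next v hv hδ hxv hvt
      obtain ⟨p, h1, h2, h3, h4⟩ := ih w (hc.lt _ _ hw).2 (.single hw) (hc.δ_step _ _ hw hδ).1 hxw
      cases p with
      | nil => simp at h2
      | cons y l =>
        simp only [List.head?_cons, Option.some.injEq] at h2
        subst h2
        refine ⟨v :: y :: l, by simp [hw, h1], rfl, by simpa using h3, ?_⟩
        intro u hu
        rcases List.mem_cons.1 hu with rfl | hu
        · exact hxv
        · exact h4 u hu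
  have hs0 : c.δ c.s < c.n := by rw [hc.δ_s]; exact lt_of_le_of_lt (Nat.zero_le _) hc.s_lt
  obtain ⟨p, h1, h2, h3, h4⟩ := key c.s hc.s_lt hs0 hs
  refine ⟨p, ⟨h1, nodup_of_isChain hc.acyclic h1, h2, h3⟩, ?_⟩
  rintro i hi ⟨ha, hb⟩
  rcases hF i hi with h | h
  · exact h (h4 _ ha)
  · exact h (h4 _ hb)

/-- The witnesses are read off a safe path: the backward arcs it traverses, its highest level, and
its vertex set. -/
theorem Correct.exists_clauses (hc : c.Correct r) (h : c.Safe r) :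
    ∃ (bits : ℕ → Prop) (D : ℕ), D < c.n ∧ ∃ x, c.Clauses bits D x := by
  obtain ⟨p, hp, hF⟩ := h
  have hs0 : c.δ c.s < c.n := by rw [hc.δ_s]; exact lt_of_le_of_lt (Nat.zero_le _) hc.s_lt
  have hsp : c.s ∈ p := List.mem_of_mem_head? hp.head
  have hch : p.IsChain r := hp.chain
  have hreach : ∀ v ∈ p, v < c.n ∧ c.δ v < c.n :=
    forall_mem_of_isChain (P := fun v => v < c.n ∧ c.δ v < c.n)
      (fun a b hab ha => ⟨(hc.lt _ _ hab).2, (hc.δ_step _ _ hab ha.2).1⟩) hch hp.head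
      ⟨hc.s_lt, hs0⟩
  obtain ⟨z, hz, hmax⟩ := exists_max_mem c.δ (List.ne_nil_of_mem hsp)
  have hlev : p.IsChain fun a b => c.δ b ≤ c.δ a + 1 := by
    refine List.IsChain.imp_of_mem_imp ?_ hch
    exact fun a b ha _ hab => (hc.δ_step _ _ hab (hreach a ha).2).2
  have mem₁ : ∀ {a b : ℕ}, [a, b] <:+: p → a ∈ p := fun h => h.subset (by simp)
  have mem₂ : ∀ {a b : ℕ}, [a, b] <:+: p → b ∈ p := fun h => h.subset (by simp)
  have cross : ∀ d < c.δ z, ∃ a b, [a, b] <:+: p ∧ c.δ a = d ∧ c.δ b = d + 1 := fun d hd =>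
    exists_crossing hlev hp.head (by rw [hc.δ_s]; exact Nat.zero_le _) hz hd
  refine ⟨fun i => [c.bt i, c.bh i] <:+: p, c.δ z, (hreach z hz).2, fun v => v ∈ p, hsp, ?_,
    fun i _ h => mem₂ h, ?_⟩
  · intro i hi
    have := hF i hi
    tauto
  intro v hv hδ
  obtain ⟨-, -, huniq⟩ := hc.mate_spec v hv hδ
  refine ⟨?_, ?_⟩
  · intro hle
    obtain ⟨u, hu, hd⟩ : ∃ u ∈ p, c.δ u = c.δ v := by
      rcases hle.lt_or_eq with hlt | heq
      · obtain ⟨a, b, hab, ha, -⟩ := cross _ hlt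
        exact ⟨a, mem₁ hab, ha⟩
      · exact ⟨z, hz, heq.symm⟩
    rcases huniq u (hreach u hu).1 hd with rfl | rfl
    · exact .inl hu
    · exact .inr hu
  · intro hvt hm
    -- The path cannot descend from `v`, since the arc used would be a guessed backward arc with
    -- tail `v`.
    have hsucc : v ∈ p → ∃ w ∈ p, r v w ∧ (c.δ w = c.δ v ∨ c.δ w = c.δ v + 1) := by
      intro hvp
      obtain ⟨w, hw⟩ := exists_next hvp hp.last hvt
      have hr := rel_of_infix hch hw
      have h1 := (hc.δ_step _ _ hr hδ).2
      have h2 : ¬ c.δ w < c.δ v := by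
        intro hlt
        obtain ⟨i, hi, ha, hb⟩ := hc.exists_back _ _ hr hδ hlt
        exact hm i hi (by simpa only [ha, hb] using hw) ha
      exact ⟨w, mem₂ hw, hr, by omega⟩
    have hne : ∀ w, r v w → w ≠ v := fun w hw e => hc.acyclic v (.single (e ▸ hw))
    -- An out-neighbour in the same level differs from `v` by acyclicity, so it is the mate.
    have huniq1 : r v (c.lit₁ v) → c.δ (c.lit₁ v) = c.δ v → ∀ w < c.n, c.δ w = c.δ v →
        w = v ∨ w = c.lit₁ v := by
      intro h1 h2 w hw hd
      rcases huniq _ (hc.lt _ _ h1).2 h2 with e | e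
      · exact absurd e (hne _ h1)
      · rw [e]; exact huniq w hw hd
    split
    · rename_i hlt
      intro hf
      have hfwd : ∀ w ∈ p, r v w → c.δ w = c.δ v + 1 →
          LitHolds c.n (fun v => v ∈ p) (c.lit₂ v) := by
        intro w hw hr hd
        rw [← hc.full_eq v hv hδ hf w hr hd, litHolds_of_lt (hreach w hw).1]
        exact hw
      rcases hc.lit₁_spec v hv hδ with ⟨e, hno⟩ | ⟨h1, h2⟩
      · rw [e, litHolds_add]
        by_cases hvp : v ∈ p
        · obtain ⟨w, hw, hr, hd⟩ := hsucc hvp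
          exact .inr (hfwd w hw hr (hd.resolve_left (hno w hr)))
        · exact .inl hvp
      · rw [litHolds_of_lt (hc.lt _ _ h1).2]
        by_cases hin : c.lit₁ v ∈ p
        · exact .inl hin
        -- The mate is missed, so the arc by which the path crosses to the next level starts at `v`,
        -- whether or not `v` was assumed on the path. This is what justifies the clause without `¬
        -- x v`.
        · obtain ⟨a, b, hab, ha, hb⟩ := cross _ hlt
          rcases huniq1 h1 h2 a (hreach a (mem₁ hab)).1 ha with rfl | rfl
          · exact .inr (hfwd b (mem₂ hab) (rel_of_infix hch hab) hb)
          · exact absurd (mem₁ hab) hin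
    · rename_i hlt
      by_cases hvp : v ∈ p
      · left
        obtain ⟨w, hw, hr, hd⟩ := hsucc hvp
        -- On the highest level the path can only continue within the level.
        have hwz := hmax w hw
        have hd : c.δ w = c.δ v := by omega
        rcases hc.lit₁_spec v hv hδ with ⟨e, hno⟩ | ⟨h1, h2⟩
        · exact absurd hd (hno w hr)
        · rw [litHolds_of_lt (hc.lt _ _ h1).2]
          rcases huniq1 h1 h2 w (hreach w hw).1 hd with e | e
          · exact absurd e (hne _ hr)
          · exact e ▸ hw
      · exact .inr hvp

end Tables

namespace RAM

open Prog

/-! ### Shortest walks by repeated relaxation -/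

/-- The relation of a list of arcs given by two arrays. -/
def EdgeRel (M : ℕ) (t h : ℕ → ℕ) (a b : ℕ) : Prop := ∃ j < M, t j = a ∧ h j = b

/-- One pass over the arcs in arrays `1`, `2`, relaxing the distances in array `3`. -/
def relaxAll : Prog :=
  forLoop 5 2 (block [.load 6 1 5, .load 7 2 5, .load 8 3 6, .succ 8, .load 9 3 7,
    .cond (.lt 8 9) (.store 3 7 8) .skip])

/-- Distances from the vertex in register `3`, in the digraph on the numbers below register `1`
with as many arcs as register `2` says, to array `3`. -/
def shortestWalks : Prog :=
  block [forLoop 4 1 (.store 3 4 1), .const 6 0, .store 3 3 6, forLoop 4 1 relaxAll]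

/-- `D` is a table of upper bounds of distances that is exact up to distance `k`. -/
def DistUpTo (r : ℕ → ℕ → Prop) (N s k : ℕ) (D : ℕ → ℕ) : Prop :=
  (∀ v < N, D v ≤ N) ∧ (∀ v < N, D v < N → WalkFrom r s (D v) v) ∧
    ∀ i ≤ k, ∀ v, WalkFrom r s i v → D v ≤ i

/-- In-place relaxation only lowers entries, and only to lengths of actual walks. Therefore the
bound obtained when an arc is treated survives the rest of the pass, and one pass gains one more
step of every walk. -/
theorem relaxAll_spec {N M s k : ℕ} {σ : State} (hM : σ.reg 2 = M)
    (hlt : ∀ j < M, σ.arr 1 j < N ∧ σ.arr 2 j < N)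
    (h : DistUpTo (EdgeRel M (σ.arr 1) (σ.arr 2)) N s k (σ.arr 3)) :
    Wp relaxAll (2 + M * (8 + 2)) σ fun τ =>
      DistUpTo (EdgeRel M (σ.arr 1) (σ.arr 2)) N s (k + 1) (τ.arr 3) := by
  set r := EdgeRel M (σ.arr 1) (σ.arr 2) with hr
  refine (Wp.forLoop (fun j τ => DistUpTo r N s k (τ.arr 3) ∧
    ∀ i < j, ∀ l ≤ k, WalkFrom r s l (σ.arr 1 i) → τ.arr 3 (σ.arr 2 i) ≤ l + 1)
    hM rfl rfl (by decide) ⟨h, by simp⟩ ?_).mono le_rfl ?_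
  · rintro j hj τ hf hij ⟨⟨h1, h2, h3⟩, h4⟩
    refine Wp.of_loopFree rfl ?_
    have e1 := hf.arr 1
    have e2 := hf.arr 2
    have hD : (eval (block [.load 6 1 5, .load 7 2 5, .load 8 3 6, .succ 8, .load 9 3 7,
        .cond (.lt 8 9) (.store 3 7 8) .skip]) τ).arr 3 =
        if τ.arr 3 (σ.arr 1 j) + 1 < τ.arr 3 (σ.arr 2 j) then
          Function.update (τ.arr 3) (σ.arr 2 j) (τ.arr 3 (σ.arr 1 j) + 1) else τ.arr 3 := by
      simp [eval, block, State.setReg_reg, Test.Holds, hij, e1, e2, apply_ite State.arr,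
        ite_apply, State.setArr_arr]
    simp only [State.setReg_arr, hD]
    set D := τ.arr 3
    set D' := if D (σ.arr 1 j) + 1 < D (σ.arr 2 j) then
          Function.update D (σ.arr 2 j) (D (σ.arr 1 j) + 1) else D with hD'
    have hle : ∀ v, D' v ≤ D v := by
      intro v
      rw [hD']
      split
      · by_cases hv : v = σ.arr 2 j
        · subst hv; simp; omega
        · simp [hv]
      · exact le_rfl
    have hj2 : D' (σ.arr 2 j) ≤ D (σ.arr 1 j) + 1 := by
      rw [hD']; split
      · simp
      · omega
    have hval : ∀ v, D' v = D v ∨ v = σ.arr 2 j ∧ D' v = D (σ.arr 1 j) + 1 := by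
      intro v
      rw [hD']; split
      · by_cases hv : v = σ.arr 2 j
        · subst hv; simp
        · simp [hv]
      · simp
    refine ⟨⟨fun v hv => (hle v).trans (h1 v hv), ?_, fun i hi v hw => (hle v).trans (h3 i hi v hw)⟩,
      ?_⟩
    · intro v hv hlt'
      rcases hval v with e | ⟨e, e'⟩
      · rw [e] at hlt' ⊢; exact h2 v hv hlt'
      · rw [e'] at hlt' ⊢
        exact ⟨_, h2 _ (hlt j hj).1 (by omega), j, hj, rfl, e.symm⟩
    · intro i hi l hl hw
      rcases Nat.lt_succ_iff_lt_or_eq.1 hi with hi | rfl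
      · exact (hle _).trans (h4 i hi l hl hw)
      · exact hj2.trans (Nat.succ_le_succ (h3 l hl _ hw))
  · rintro τ hf ⟨⟨h1, h2, h3⟩, h4⟩
    refine ⟨h1, h2, ?_⟩
    intro i hi v hw
    rcases Nat.le_succ_iff.1 hi with hi | rfl
    · exact h3 i hi v hw
    · obtain ⟨u, hu, j, hj, rfl, rfl⟩ := hw
      exact h4 j hj k le_rfl hu

/-- `D` is the table of distances from `s`, with `N` for unreachable vertices. -/
structure IsDist (r : ℕ → ℕ → Prop) (N s : ℕ) (D : ℕ → ℕ) : Prop where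
  le : ∀ v < N, D v ≤ N
  walk : ∀ v < N, D v < N → WalkFrom r s (D v) v
  min : ∀ v < N, ∀ k, WalkFrom r s k v → D v ≤ k

/-- A reachable vertex is reached by a walk with fewer than `N` steps, so the value `N` marks
exactly the unreachable vertices. -/
theorem IsDist.lt_iff {r : ℕ → ℕ → Prop} {N s : ℕ} {D : ℕ → ℕ} (h : IsDist r N s D)
    (hr : ∀ a b, r a b → b < N) (hs : s < N) {v : ℕ} (hv : v < N) :
    D v < N ↔ Relation.ReflTransGen r s v := by
  constructor
  · exact fun hd => (h.walk v hv hd).reflTransGen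
  · intro hw
    obtain ⟨k, hk⟩ := exists_walkFrom hw
    obtain ⟨k', hlt, hk'⟩ := hk.exists_lt hs hr
    exact (h.min v hv k' hk').trans_lt hlt

theorem shortestWalks_spec {N M s Z : ℕ} {σ : State} (hN : σ.reg 1 = N) (hM : σ.reg 2 = M)
    (hs : σ.reg 3 = s) (hsN : s < N) (hlt : ∀ j < M, σ.arr 1 j < N ∧ σ.arr 2 j < N)
    (hNZ : N ≤ Z) (hMZ : M ≤ Z) :
    Wp shortestWalks (25 * Z ^ 2) σ fun τ =>
      IsDist (EdgeRel M (σ.arr 1) (σ.arr 2)) N s (τ.arr 3) := by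
  have hZ : 1 ≤ Z := by omega
  have hb : (2 + N * (1 + 2)) + (1 + (1 + (2 + N * ((2 + M * (8 + 2)) + 2)))) ≤ 25 * Z ^ 2 := by
    have h1 : N * M ≤ Z * Z := Nat.mul_le_mul hNZ hMZ
    nlinarith
  refine Wp.mono ?_ hb fun _ _ h => h
  refine Wp.seq (Q := fun τ => ∀ i < N, τ.arr 3 i = N)
    (Wp.forLoop (fun j τ => ∀ i < j, τ.arr 3 i = N) hN rfl rfl (by decide) (by simp) ?_) ?_
  · intro j hj τ hf hij h
    refine Wp.of_loopFree rfl ?_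
    intro i hi
    have e1 := hf.reg 1
    simp only [eval, State.setReg_arr, State.setArr_arr, hij, e1, hN, if_true,
      Function.update_apply]
    split
    · rfl
    · exact h i (by omega)
  intro τ hf h
  refine Wp.seq (Wp.of_loopFree (Q := fun υ => υ = τ.setReg 6 0) rfl rfl) ?_
  rintro υ - rfl
  refine Wp.seq (Wp.of_loopFree
    (Q := fun υ => υ = (τ.setReg 6 0).setArr 3 s 0) rfl ?_) ?_
  · simp [eval, State.setReg_reg, hf.reg 3, hs]
  rintro υ - rfl
  have e1 := hf.arr 1
  have e2 := hf.arr 2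
  refine (Wp.forLoop (fun j τ => DistUpTo (EdgeRel M (σ.arr 1) (σ.arr 2)) N s j (τ.arr 3))
    (by simp [State.setReg_reg, hf.reg 1, hN]) rfl rfl (by decide) ?_ ?_).mono le_rfl ?_
  · simp only [State.setReg_arr, State.setArr_arr, if_true]
    refine ⟨?_, ?_, ?_⟩
    · intro v hv
      by_cases hvs : v = s
      · simp [hvs]
      · simp [hvs, h v hv]
    · intro v hv
      by_cases hvs : v = s
      · simp [hvs, WalkFrom]
      · simp [hvs, h v hv]
    · intro i hi v hw
      obtain rfl : i = 0 := by omega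
      cases hw
      simp
  · intro j hj υ hf' hij h'
    have f1 : υ.arr 1 = σ.arr 1 := by rw [hf'.arr 1]; simpa [State.setArr_arr] using e1
    have f2 : υ.arr 2 = σ.arr 2 := by rw [hf'.arr 2]; simpa [State.setArr_arr] using e2
    have := relaxAll_spec (N := N) (M := M) (s := s) (k := j) (σ := υ)
      (by rw [hf'.reg 2]; simp [State.setReg_reg, hf.reg 2, hM])
      (by rw [f1, f2]; exact hlt) (by rw [f1, f2]; exact h')
    rw [f1, f2] at this
    exact this
  · rintro υ - ⟨h1, h2, h3⟩
    refine ⟨h1, h2, ?_⟩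
    intro v hv k hk
    -- After `N` passes, longer walks impose nothing new, because all entries are at most `N`.
    by_cases hkN : k ≤ N
    · exact h3 k hkN v hk
    · have := h1 v hv; omega

end RAM

namespace RAM

open Prog

/-- Both descriptions of the intermediate state are kept: the exact one for the cells just written,
the frame for all others. -/
theorem Wp.seq_eval {p q : Prog} {C : ℕ} {σ : State} {R : State → Prop} (hp : p.loopFree = true)
    (h : ∀ τ, τ = p.eval σ → Frame p σ τ → Wp q C τ R) : Wp (.seq p q) (p.cost + C) σ R :=
  Wp.seq (Wp.of_loopFree (Q := fun τ => τ = p.eval σ) hp rfl) fun τ hf e => h τ e hf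

/-! ### The memory layout of the search -/

/-- The tables are in memory. -/
structure Env (c : Tables) (σ : State) : Prop where
  n : σ.reg 20 = c.n
  s : σ.reg 21 = c.s
  t : σ.reg 22 = c.t
  q : σ.reg 24 = c.q
  k : σ.reg 25 = c.k
  nn : σ.reg 26 = 2 * c.n
  zero : σ.reg 27 = 0
  one : σ.reg 28 = 1
  δ : σ.arr 4 = c.δ
  mate : σ.arr 5 = c.mate
  lit₁ : σ.arr 6 = c.lit₁
  lit₂ : σ.arr 7 = c.lit₂
  full : σ.arr 8 = c.full
  bt : σ.arr 9 = c.bt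
  bh : σ.arr 10 = c.bh
  fa : σ.arr 13 = c.fa
  fb : σ.arr 14 = c.fb
  neg : ∀ l < 2 * c.n, σ.arr 15 l = negLit c.n l

/-- The program does not write to the tables. -/
def Prog.keepsEnv (p : Prog) : Bool :=
  [20, 21, 22, 24, 25, 26, 27, 28].all (fun x => !p.wr x) &&
    [4, 5, 6, 7, 8, 9, 10, 13, 14, 15].all (fun a => !p.wa a)

theorem Env.frame {c : Tables} {p : Prog} {σ τ : State} (h : Env c σ) (hf : Frame p σ τ)
    (hp : p.keepsEnv = true := by rfl) : Env c τ := by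
  simp only [Prog.keepsEnv, List.all_cons, List.all_nil, Bool.and_true, Bool.and_eq_true,
    Bool.not_eq_true'] at hp
  obtain ⟨⟨r20, r21, r22, r24, r25, r26, r27, r28⟩, a4, a5, a6, a7, a8, a9, a10, a13, a14, a15⟩ := hp
  exact ⟨(hf.1 _ r20).trans h.n, (hf.1 _ r21).trans h.s, (hf.1 _ r22).trans h.t,
    (hf.1 _ r24).trans h.q, (hf.1 _ r25).trans h.k, (hf.1 _ r26).trans h.nn,
    (hf.1 _ r27).trans h.zero, (hf.1 _ r28).trans h.one, (hf.2 _ a4).trans h.δ,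
    (hf.2 _ a5).trans h.mate, (hf.2 _ a6).trans h.lit₁, (hf.2 _ a7).trans h.lit₂,
    (hf.2 _ a8).trans h.full, (hf.2 _ a9).trans h.bt, (hf.2 _ a10).trans h.bh,
    (hf.2 _ a13).trans h.fa, (hf.2 _ a14).trans h.fb, by rw [hf.2 _ a15]; exact h.neg⟩

/-! ### Lists of clauses as lists of implications -/

/-- Arrays `1`, `2` hold at most `b` implications between literals, the contrapositive of each
among them, which together are equivalent to `Φ`. -/
structure Implications (n b : ℕ) (Φ : (ℕ → Prop) → Prop) (σ : State) : Prop where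
  le : σ.reg 2 ≤ b
  lt : ∀ j < σ.reg 2, σ.arr 1 j < 2 * n ∧ σ.arr 2 j < 2 * n
  -- This is the skew symmetry required by `exists_assignment_iff`.
  skew : ∀ j < σ.reg 2, ∃ i < σ.reg 2, σ.arr 1 i = negLit n (σ.arr 2 j) ∧
    σ.arr 2 i = negLit n (σ.arr 1 j)
  iff : ∀ x, (∀ j < σ.reg 2, LitHolds n x (σ.arr 1 j) → LitHolds n x (σ.arr 2 j)) ↔ Φ x

theorem Implications.mono {n b b' : ℕ} {Φ Ψ : (ℕ → Prop) → Prop} {σ τ : State}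
    (h : Implications n b Φ σ) (hb : b ≤ b') (h2 : τ.reg 2 = σ.reg 2) (h1 : τ.arr 1 = σ.arr 1)
    (h1' : τ.arr 2 = σ.arr 2) (hΦ : ∀ x, Φ x ↔ Ψ x) : Implications n b' Ψ τ := by
  obtain ⟨k1, k2, k3, k4⟩ := h
  refine ⟨?_, ?_, ?_, ?_⟩
  · rw [h2]; exact k1.trans hb
  · rw [h2, h1, h1']; exact k2
  · rw [h2, h1, h1']; exact k3
  · intro x; rw [h2, h1, h1', ← hΦ]; exact k4 x

/-- Append the clause made of the literals in the registers `a` and `b`. -/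
def push (a b : ℕ) : Prog :=
  block [.load 18 15 a, .store 1 2 18, .store 2 2 b, .succ 2,
    .load 18 15 b, .store 1 2 18, .store 2 2 a, .succ 2]

/-- A clause `l ∨ l'` is the pair of implications `¬ l → l'` and `¬ l' → l`. They are
contrapositives of each other, so appending both preserves skew symmetry. Unit clauses arise by
using one register twice. -/
theorem push_spec {c : Tables} {a b : ℕ} (ha : a ≠ 18 ∧ a ≠ 2) (hb : b ≠ 18 ∧ b ≠ 2) {m : ℕ}
    {Φ : (ℕ → Prop) → Prop} {σ : State} (he : Env c σ) (h : Implications c.n m Φ σ)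
    (h1 : σ.reg a < 2 * c.n) (h2 : σ.reg b < 2 * c.n) :
    Wp (push a b) 8 σ (Implications c.n (m + 2)
      fun x => Φ x ∧ (LitHolds c.n x (σ.reg a) ∨ LitHolds c.n x (σ.reg b))) := by
  refine Wp.of_loopFree rfl ?_
  generalize hτ : (push a b).eval σ = τ
  generalize hl : σ.reg a = l at *
  generalize hl' : σ.reg b = l' at *
  have r2 : τ.reg 2 = σ.reg 2 + 2 := by
    simp [← hτ, push, block, eval, State.setReg_reg]
  have a1 : τ.arr 1 = Function.update (Function.update (σ.arr 1) (σ.reg 2) (negLit c.n l))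
      (σ.reg 2 + 1) (negLit c.n l') := by
    simp [← hτ, push, block, eval, State.setReg_reg, State.setArr_arr, ha, hb, hl, hl',
      he.neg l h1, he.neg l' h2]
  have a2 : τ.arr 2 = Function.update (Function.update (σ.arr 2) (σ.reg 2) l')
      (σ.reg 2 + 1) l := by
    simp [← hτ, push, block, eval, State.setReg_reg, State.setArr_arr, ha, hb, hl, hl']
  have old : ∀ j < σ.reg 2, τ.arr 1 j = σ.arr 1 j ∧ τ.arr 2 j = σ.arr 2 j := by
    intro j hj
    have e1 : j ≠ σ.reg 2 + 1 := by omega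
    have e2 : j ≠ σ.reg 2 := by omega
    simp [a1, a2, e1, e2]
  have n1 : τ.arr 1 (σ.reg 2) = negLit c.n l ∧ τ.arr 2 (σ.reg 2) = l' := by simp [a1, a2]
  have n2 : τ.arr 1 (σ.reg 2 + 1) = negLit c.n l' ∧ τ.arr 2 (σ.reg 2 + 1) = l := by simp [a1, a2]
  have split : ∀ {P : ℕ → Prop}, (∀ j < τ.reg 2, P j) ↔
      (∀ j < σ.reg 2, P j) ∧ P (σ.reg 2) ∧ P (σ.reg 2 + 1) := by
    intro P
    rw [r2]
    refine ⟨fun h => ⟨fun j hj => h j (by omega), h _ (by omega), h _ (by omega)⟩, ?_⟩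
    rintro ⟨k1, k2, k3⟩ j hj
    rcases Nat.lt_succ_iff_lt_or_eq.1 hj with hj | rfl
    · rcases Nat.lt_succ_iff_lt_or_eq.1 hj with hj | rfl
      · exact k1 j hj
      · exact k2
    · exact k3
  obtain ⟨k1, k2, k3, k4⟩ := h
  refine ⟨by omega, split.2 ⟨?_, ?_, ?_⟩, split.2 ⟨?_, ?_, ?_⟩, ?_⟩
  · intro j hj; rw [(old j hj).1, (old j hj).2]; exact k2 j hj
  · rw [n1.1, n1.2]; exact ⟨negLit_lt h1, h2⟩
  · rw [n2.1, n2.2]; exact ⟨negLit_lt h2, h1⟩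
  · intro j hj
    obtain ⟨i, hi, e⟩ := k3 j hj
    exact ⟨i, by omega, by rw [(old j hj).1, (old j hj).2, (old i hi).1, (old i hi).2]; exact e⟩
  · refine ⟨σ.reg 2 + 1, by omega, ?_⟩
    rw [n1.1, n1.2, n2.1, n2.2, negLit_negLit h1]; exact ⟨rfl, rfl⟩
  · refine ⟨σ.reg 2, by omega, ?_⟩
    rw [n1.1, n1.2, n2.1, n2.2, negLit_negLit h2]; exact ⟨rfl, rfl⟩
  · intro x
    rw [split, n1.1, n1.2, n2.1, n2.2, litHolds_negLit h1, litHolds_negLit h2, ← k4]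
    have : (∀ j < σ.reg 2, LitHolds c.n x (τ.arr 1 j) → LitHolds c.n x (τ.arr 2 j)) ↔
        ∀ j < σ.reg 2, LitHolds c.n x (σ.arr 1 j) → LitHolds c.n x (σ.arr 2 j) :=
      forall₂_congr fun j hj => by rw [(old j hj).1, (old j hj).2]
    rw [this]
    tauto

/-! ### Making the clauses -/

/-- Clauses for the forbidden pairs. -/
def pairClauses : Prog :=
  forLoop 11 24 (.seq (block [.load 12 13 11, .load 12 15 12, .load 13 14 11, .load 13 15 13])
    (push 12 13))

/-- Clauses for the selected backward arcs, whose tails are marked. -/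
def backClauses : Prog :=
  forLoop 11 25 (.seq (.load 12 11 11) (.cond (.eq 12 28)
    (.seq (block [.load 12 9 11, .load 13 10 11, .store 12 12 28]) (push 13 13)) .skip))

/-- The clause that a level up to the highest one is visited. -/
def levelClause : Prog :=
  .cond (.lt 30 12) .skip (.seq (.load 13 5 11) (push 11 13))

/-- The clause for the arc by which an unmarked vertex is left. -/
def arcClause : Prog :=
  .seq (.load 13 12 11) (.cond (.eq 13 27)
    (.seq (.load 14 6 11) (.cond (.lt 12 30)
      (.seq (block [.load 16 8 11, .load 15 7 11]) (.cond (.eq 16 27) (push 14 15) .skip))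
      (.seq (.load 15 15 11) (push 14 15))))
    .skip)

/-- Clauses for all reachable vertices. -/
def vertexClauses : Prog :=
  forLoop 11 20 (.seq (.load 12 4 11) (.cond (.lt 12 20) (.seq levelClause arcClause) .skip))

/-- All clauses, for the highest level in register `30` and the selection in array `11`. -/
def makeClauses : Prog :=
  -- The mark on `t` in array `12` exempts it from having an out-neighbour, as for the tails of
  -- selected backward arcs; `push 21 21` is the unit clause for `s`.
  block [.const 2 0, forLoop 11 20 (.store 12 11 27), .store 12 22 28, push 21 21,
    pairClauses, backClauses, vertexClauses]

/-! ### Correctness and cost of clause generation -/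

variable {c : Tables} {r : ℕ → ℕ → Prop}

theorem pairClauses_spec (hc : c.Correct r) {b : ℕ} {Φ : (ℕ → Prop) → Prop} {σ : State}
    (he : Env c σ) (h : Implications c.n b Φ σ) :
    Wp pairClauses (2 + c.q * (12 + 2)) σ (Implications c.n (b + 2 * c.q)
      fun x => Φ x ∧ ∀ i < c.q, ¬ x (c.fa i) ∨ ¬ x (c.fb i)) := by
  refine (Wp.forLoop (fun j => Implications c.n (b + 2 * j)
      fun x => Φ x ∧ ∀ i < j, ¬ x (c.fa i) ∨ ¬ x (c.fb i)) he.q rfl rfl (by decide)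
      (h.mono le_rfl rfl rfl rfl (by simp)) ?_)
  intro j hj τ hf hij hinv
  have heτ := he.frame hf
  refine Wp.seq_eval (C := 8) rfl ?_
  intro υ hυ hfυ
  have hfa := hc.fa_lt j hj
  have hfb := hc.fb_lt j hj
  have e12 : υ.reg 12 = c.n + c.fa j := by
    simp [hυ, eval, block, State.setReg_reg, hij, heτ.fa, heτ.neg _ (show c.fa j < 2 * c.n by omega),
      negLit, hfa]
  have e13 : υ.reg 13 = c.n + c.fb j := by
    simp [hυ, eval, block, State.setReg_reg, hij, heτ.fb, heτ.neg _ (show c.fb j < 2 * c.n by omega),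
      negLit, hfb]
  refine (push_spec (by decide) (by decide) (heτ.frame hfυ)
    (hinv.mono le_rfl (hfυ.reg 2) (hfυ.arr 1) (hfυ.arr 2) fun _ => Iff.rfl)
    (by omega) (by omega)).mono le_rfl ?_
  intro ρ _ h'
  refine h'.mono (by omega) rfl rfl rfl ?_
  intro x
  rw [e12, e13, litHolds_add, litHolds_add, Nat.forall_lt_succ_right, and_assoc]

/-- Besides the unit clauses for the heads, the pass leaves in array `12` exactly the marks that
decide which vertices receive an arc clause. -/
theorem backClauses_spec (hc : c.Correct r) {b : ℕ} {Φ : (ℕ → Prop) → Prop} {σ : State}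
    (he : Env c σ) (h : Implications c.n b Φ σ)
    (hm : ∀ v < c.n, σ.arr 12 v = 0 ↔ v ≠ c.t) :
    Wp backClauses (2 + c.k * (13 + 2)) σ fun τ => Implications c.n (b + 2 * c.k)
      (fun x => Φ x ∧ ∀ i < c.k, σ.arr 11 i = 1 → x (c.bh i)) τ ∧
      ∀ v < c.n, τ.arr 12 v = 0 ↔ v ≠ c.t ∧ ∀ i < c.k, σ.arr 11 i = 1 → c.bt i ≠ v := by
  refine (Wp.forLoop (fun j τ => Implications c.n (b + 2 * j)
      (fun x => Φ x ∧ ∀ i < j, σ.arr 11 i = 1 → x (c.bh i)) τ ∧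
      ∀ v < c.n, τ.arr 12 v = 0 ↔ v ≠ c.t ∧ ∀ i < j, σ.arr 11 i = 1 → c.bt i ≠ v)
      he.k rfl rfl (by decide) ⟨h.mono le_rfl rfl rfl rfl (by simp), by simpa using hm⟩ ?_)
  rintro j hj τ hf hij ⟨hinv, hmark⟩
  have heτ := he.frame hf
  refine Wp.seq_eval (C := 12) rfl ?_
  intro υ hυ hfυ
  have e12 : υ.reg 12 = σ.arr 11 j := by
    simp [hυ, eval, State.setReg_reg, hij, hf.arr 11]
  have heυ := heτ.frame hfυ
  have hinvυ := hinv.mono le_rfl (hfυ.reg 2) (hfυ.arr 1) (hfυ.arr 2) fun _ => Iff.rfl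
  have hmarkυ := hmark
  rw [← hfυ.arr 12] at hmarkυ
  have ijυ : υ.reg 11 = j := (hfυ.reg 11).trans hij
  refine Wp.cond (fun hb => ?_) fun hb => ?_
  · have hbit : σ.arr 11 j = 1 := by rw [← e12, ← heυ.one]; exact hb
    obtain ⟨hbt, hbh⟩ := hc.lt _ _ (hc.back_rel j hj)
    refine Wp.seq_eval (C := 8) rfl ?_
    intro ρ hρ hfρ
    have e13 : ρ.reg 13 = c.bh j := by
      simp [hρ, eval, block, State.setReg_reg, ijυ, heυ.bh]
    have a12 : ρ.arr 12 = Function.update (υ.arr 12) (c.bt j) 1 := by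
      simp [hρ, eval, block, State.setReg_reg, State.setArr_arr, ijυ, heυ.bt, heυ.one]
    refine (push_spec (by decide) (by decide) (heυ.frame hfρ)
      (hinvυ.mono le_rfl (hfρ.reg 2) (hfρ.arr 1) (hfρ.arr 2) fun _ => Iff.rfl)
      (by omega) (by omega)).mono le_rfl ?_
    intro π hfπ h'
    refine ⟨h'.mono (by omega) rfl rfl rfl ?_, ?_⟩
    · intro x
      simp only [e13, litHolds_of_lt hbh, or_self, Nat.forall_lt_succ_right, hbit, true_imp_iff,
        and_assoc]
    · intro v hv
      rw [State.setReg_arr, hfπ.arr 12, a12, Nat.forall_lt_succ_right]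
      by_cases hvb : v = c.bt j
      · subst hvb; simp [hbit]
      · rw [Function.update_of_ne hvb, hmarkυ v hv]
        have : c.bt j ≠ v := fun e => hvb e.symm
        simp [this]
  · have hbit : σ.arr 11 j ≠ 1 := by rw [← e12, ← heυ.one]; exact hb
    refine (Wp.of_loopFree (Q := fun ρ => ρ = υ) rfl rfl).mono (by decide) ?_
    rintro ρ - rfl
    refine ⟨hinvυ.mono (by omega) rfl rfl rfl ?_, ?_⟩
    · intro x
      simp only [Nat.forall_lt_succ_right, hbit, false_imp_iff, and_true]
    · intro v hv
      rw [State.setReg_arr, hmarkυ v hv]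
      simp only [Nat.forall_lt_succ_right, hbit, false_imp_iff, and_true]

theorem _root_.Tables.Correct.lit₁_lt (hc : c.Correct r) {v : ℕ} (hv : v < c.n) (hδ : c.δ v < c.n) :
    c.lit₁ v < 2 * c.n := by
  rcases hc.lit₁_spec v hv hδ with h | h
  · omega
  · have := (hc.lt _ _ h.1).2; omega

theorem _root_.Tables.Correct.lit₂_lt (hc : c.Correct r) {v : ℕ} (hv : v < c.n) (hδ : c.δ v < c.n) :
    c.lit₂ v < 2 * c.n := by
  rcases hc.lit₂_spec v hv hδ with h | h
  · omega
  · have := (hc.lt _ _ h.1).2; omega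

theorem levelClause_spec (hc : c.Correct r) {b v D : ℕ} {Φ : (ℕ → Prop) → Prop} {σ : State}
    (he : Env c σ) (h : Implications c.n b Φ σ) (h11 : σ.reg 11 = v) (h12 : σ.reg 12 = c.δ v)
    (h30 : σ.reg 30 = D) (hv : v < c.n) (hδ : c.δ v < c.n) :
    Wp levelClause 10 σ (Implications c.n (b + 2)
      fun x => Φ x ∧ (c.δ v ≤ D → x v ∨ x (c.mate v))) := by
  refine Wp.cond (fun hb => ?_) fun hb => ?_
  · refine (Wp.of_loopFree (Q := fun ρ => ρ = σ) rfl rfl).mono (by decide) ?_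
    rintro ρ - rfl
    simp only [Test.Holds, h12, h30] at hb
    exact h.mono (by omega) rfl rfl rfl fun x => by simp [hb]
  · simp only [Test.Holds, h12, h30] at hb
    refine Wp.seq_eval (C := 8) rfl ?_
    intro ρ hρ hfρ
    have e13 : ρ.reg 13 = c.mate v := by simp [hρ, eval, State.setReg_reg, h11, he.mate]
    have e11 : ρ.reg 11 = v := (hfρ.reg 11).trans h11
    have hmate := (hc.mate_spec v hv hδ).1
    refine (push_spec (by decide) (by decide) (he.frame hfρ)
      (h.mono le_rfl (hfρ.reg 2) (hfρ.arr 1) (hfρ.arr 2) fun _ => Iff.rfl)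
      (by omega) (by omega)).mono le_rfl ?_
    intro π hfπ h'
    refine h'.mono le_rfl rfl rfl rfl fun x => ?_
    rw [e11, e13, litHolds_of_lt hv, litHolds_of_lt hmate]
    simp [show c.δ v ≤ D by omega]

/-- All case distinctions in the formula concern tables, marks and `D`, not the variables; they are
resolved while generating, so at most one 2-clause is emitted. -/
theorem arcClause_spec (hc : c.Correct r) {b v D : ℕ} {Φ : (ℕ → Prop) → Prop} {σ : State}
    (he : Env c σ) (h : Implications c.n b Φ σ) (h11 : σ.reg 11 = v) (h12 : σ.reg 12 = c.δ v)
    (h30 : σ.reg 30 = D) (hv : v < c.n) (hδ : c.δ v < c.n) :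
    Wp arcClause 15 σ (Implications c.n (b + 2)
      fun x => Φ x ∧ (σ.arr 12 v = 0 → if c.δ v < D then
        c.full v = 0 → LitHolds c.n x (c.lit₁ v) ∨ LitHolds c.n x (c.lit₂ v)
      else LitHolds c.n x (c.lit₁ v) ∨ ¬ x v)) := by
  refine Wp.seq_eval (C := 14) rfl ?_
  intro υ hυ hfυ
  have e13 : υ.reg 13 = σ.arr 12 v := by simp [hυ, eval, State.setReg_reg, h11]
  have h11 : υ.reg 11 = v := (hfυ.reg 11).trans h11
  have h12 : υ.reg 12 = c.δ v := (hfυ.reg 12).trans h12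
  have h30 : υ.reg 30 = D := (hfυ.reg 30).trans h30
  replace he := he.frame hfυ
  replace h := h.mono le_rfl (hfυ.reg 2) (hfυ.arr 1) (hfυ.arr 2) fun _ => Iff.rfl
  clear hυ hfυ
  have hlit₁ := hc.lit₁_lt hv hδ
  have hlit₂ := hc.lit₂_lt hv hδ
  refine Wp.cond (fun hb => ?_) fun hb => ?_
  · simp only [Test.Holds, e13, he.zero] at hb
    refine Wp.seq_eval (C := 12) rfl ?_
    intro ρ hρ hfρ
    have e14 : ρ.reg 14 = c.lit₁ v := by simp [hρ, eval, State.setReg_reg, h11, he.lit₁]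
    have h11 : ρ.reg 11 = v := (hfρ.reg 11).trans h11
    have h12 : ρ.reg 12 = c.δ v := (hfρ.reg 12).trans h12
    have h30 : ρ.reg 30 = D := (hfρ.reg 30).trans h30
    replace he := he.frame hfρ
    replace h := h.mono le_rfl (hfρ.reg 2) (hfρ.arr 1) (hfρ.arr 2) fun _ => Iff.rfl
    clear hρ hfρ
    refine Wp.cond (fun hb' => ?_) fun hb' => ?_
    · simp only [Test.Holds, h12, h30] at hb'
      refine Wp.seq_eval (C := 9) rfl ?_
      intro π hπ hfπ
      have e15 : π.reg 15 = c.lit₂ v := by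
        simp [hπ, eval, block, State.setReg_reg, h11, he.lit₂]
      have e16 : π.reg 16 = c.full v := by
        simp [hπ, eval, block, State.setReg_reg, h11, he.full]
      have e14 : π.reg 14 = c.lit₁ v := (hfπ.reg 14).trans e14
      replace he := he.frame hfπ
      replace h := h.mono le_rfl (hfπ.reg 2) (hfπ.arr 1) (hfπ.arr 2) fun _ => Iff.rfl
      clear hπ hfπ
      refine Wp.cond (fun hf => ?_) fun hf => ?_
      · simp only [Test.Holds, e16, he.zero] at hf
        refine (push_spec (by decide) (by decide) he h (by omega) (by omega)).mono le_rfl ?_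
        intro _ _ h'
        refine h'.mono le_rfl rfl rfl rfl fun x => ?_
        simp [e14, e15, hb, hb', hf]
      · simp only [Test.Holds, e16, he.zero] at hf
        refine (Wp.of_loopFree (Q := fun ρ => ρ = π) rfl rfl).mono (by decide) ?_
        rintro ρ - rfl
        exact h.mono (by omega) rfl rfl rfl fun x => by simp [hb', hf]
    · simp only [Test.Holds, h12, h30] at hb'
      refine (Wp.seq_eval (C := 8) rfl ?_).mono (show _ ≤ 11 by decide) fun _ _ h => h
      intro π hπ hfπ
      have e15 : π.reg 15 = c.n + v := by
        simp [hπ, eval, State.setReg_reg, h11, he.neg v (by omega), negLit, hv]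
      have e14 : π.reg 14 = c.lit₁ v := (hfπ.reg 14).trans e14
      refine (push_spec (by decide) (by decide) (he.frame hfπ)
        (h.mono le_rfl (hfπ.reg 2) (hfπ.arr 1) (hfπ.arr 2) fun _ => Iff.rfl)
        (by omega) (by omega)).mono le_rfl ?_
      intro _ _ h'
      refine h'.mono le_rfl rfl rfl rfl fun x => ?_
      rw [e14, e15, litHolds_add]
      simp [hb, hb']
  · simp only [Test.Holds, e13, he.zero] at hb
    refine (Wp.of_loopFree (Q := fun ρ => ρ = υ) rfl rfl).mono (by decide) ?_
    rintro ρ - rfl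
    exact h.mono (by omega) rfl rfl rfl fun x => by simp [hb]

theorem vertexClauses_spec (hc : c.Correct r) {b D : ℕ} {Φ : (ℕ → Prop) → Prop} {σ : State}
    (he : Env c σ) (h : Implications c.n b Φ σ) (h30 : σ.reg 30 = D) :
    Wp vertexClauses (2 + c.n * (27 + 2)) σ (Implications c.n (b + 4 * c.n)
      fun x => Φ x ∧ ∀ v < c.n, c.δ v < c.n → (c.δ v ≤ D → x v ∨ x (c.mate v)) ∧
        (σ.arr 12 v = 0 → if c.δ v < D then
          c.full v = 0 → LitHolds c.n x (c.lit₁ v) ∨ LitHolds c.n x (c.lit₂ v)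
        else LitHolds c.n x (c.lit₁ v) ∨ ¬ x v)) := by
  refine (Wp.forLoop (fun j => Implications c.n (b + 4 * j)
      fun x => Φ x ∧ ∀ v < j, c.δ v < c.n → (c.δ v ≤ D → x v ∨ x (c.mate v)) ∧
        (σ.arr 12 v = 0 → if c.δ v < D then
          c.full v = 0 → LitHolds c.n x (c.lit₁ v) ∨ LitHolds c.n x (c.lit₂ v)
        else LitHolds c.n x (c.lit₁ v) ∨ ¬ x v))
      he.n rfl rfl (by decide) (h.mono le_rfl rfl rfl rfl (by simp)) ?_)
  intro j hj τ hf hij hinv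
  have heτ := he.frame hf
  refine Wp.seq_eval (C := 26) rfl ?_
  intro υ hυ hfυ
  have e12 : υ.reg 12 = c.δ j := by simp [hυ, eval, State.setReg_reg, hij, heτ.δ]
  have ijυ : υ.reg 11 = j := (hfυ.reg 11).trans hij
  have h30υ : υ.reg 30 = D := ((hfυ.reg 30).trans (hf.reg 30)).trans h30
  have a12 : υ.arr 12 = σ.arr 12 := (hfυ.arr 12).trans (hf.arr 12)
  have heυ := heτ.frame hfυ
  replace hinv := hinv.mono le_rfl (hfυ.reg 2) (hfυ.arr 1) (hfυ.arr 2) fun _ => Iff.rfl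
  refine Wp.cond (fun hb => ?_) fun hb => ?_
  · simp only [Test.Holds, e12, heυ.n] at hb
    refine Wp.seq (C := 15) (levelClause_spec hc heυ hinv ijυ e12 h30υ hj hb) ?_
    intro ρ hfρ hρ
    refine (arcClause_spec hc (heυ.frame hfρ) hρ ((hfρ.reg 11).trans ijυ)
      ((hfρ.reg 12).trans e12) ((hfρ.reg 30).trans h30υ) hj hb).mono le_rfl ?_
    intro π _ h'
    refine h'.mono (by omega) rfl rfl rfl fun x => ?_
    rw [hfρ.arr 12, a12]
    simp only [Nat.forall_lt_succ_right, hb, true_imp_iff, and_assoc]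
  · simp only [Test.Holds, e12, heυ.n] at hb
    refine (Wp.of_loopFree (Q := fun ρ => ρ = υ) rfl rfl).mono (by decide) ?_
    rintro ρ - rfl
    exact hinv.mono (by omega) rfl rfl rfl fun x => by
      simp only [Nat.forall_lt_succ_right, hb, false_imp_iff, and_true]

/-- The count allots two implications to each clause: one clause for `s`, one per forbidden pair, at
most one per backward arc and at most two per vertex. -/
theorem makeClauses_spec (hc : c.Correct r) {D Z : ℕ} {σ : State} (he : Env c σ)
    (h30 : σ.reg 30 = D) (hn : c.n ≤ Z) (hk : c.k ≤ Z) (hq : c.q ≤ Z) :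
    Wp makeClauses (79 * Z) σ (Implications c.n (2 + 2 * c.q + 2 * c.k + 4 * c.n)
      fun x => c.Clauses (fun i => σ.arr 11 i = 1) D x) := by
  have hn0 : 0 < c.n := (Nat.zero_le _).trans_lt hc.s_lt
  have hb : 1 + ((2 + c.n * (1 + 2)) + (1 + (8 + ((2 + c.q * (12 + 2)) +
      ((2 + c.k * (13 + 2)) + (2 + c.n * (27 + 2))))))) ≤ 79 * Z := by omega
  refine Wp.mono ?_ hb fun _ _ h => h
  refine Wp.seq_eval rfl fun τ₁ e₁ f₁ => ?_
  have he₁ := he.frame f₁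
  refine Wp.seq (Wp.forLoop (fun j τ => ∀ v < j, τ.arr 12 v = 0) he₁.n rfl rfl (by decide)
    (by simp) ?_) ?_
  · intro j hj τ hf hij hinv
    refine Wp.of_loopFree rfl ?_
    intro i hi
    simp only [eval, State.setReg_arr, State.setArr_arr, hij, (he₁.frame hf).zero, if_true,
      Function.update_apply]
    split
    · rfl
    · exact hinv i (by omega)
  intro τ₂ f₂ e₂
  have he₂ := he₁.frame f₂
  refine Wp.seq_eval rfl fun τ₃ e₃ f₃ => ?_
  have he₃ := he₂.frame f₃
  have r2 : τ₃.reg 2 = 0 := by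
    rw [f₃.reg 2, f₂.reg 2, e₁]; simp [eval, State.setReg_reg]
  have h₃ : Implications c.n 0 (fun _ => True) τ₃ := by
    refine ⟨r2.le, ?_, ?_, ?_⟩ <;> simp [r2]
  have m₃ : ∀ v < c.n, τ₃.arr 12 v = 0 ↔ v ≠ c.t := by
    intro v hv
    simp only [e₃, eval, State.setArr_arr, if_true, he₂.t, he₂.one]
    by_cases hvt : v = c.t
    · simp [hvt]
    · simp [hvt, e₂ v hv]
  have hs := hc.s_lt
  refine Wp.seq (push_spec (by decide) (by decide) he₃ h₃ (by rw [he₃.s]; omega)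
    (by rw [he₃.s]; omega)) fun τ₄ f₄ h₄ => ?_
  have he₄ := he₃.frame f₄
  refine Wp.seq (pairClauses_spec hc he₄ h₄) fun τ₅ f₅ h₅ => ?_
  have he₅ := he₄.frame f₅
  refine Wp.seq (backClauses_spec hc he₅ h₅ (by rw [f₅.arr 12, f₄.arr 12]; exact m₃))
    fun τ₆ f₆ h₆ => ?_
  have he₆ := he₅.frame f₆
  have h30' : τ₆.reg 30 = D := by
    rw [f₆.reg 30, f₅.reg 30, f₄.reg 30, f₃.reg 30, f₂.reg 30, f₁.reg 30, h30]
  have a11 : τ₅.arr 11 = σ.arr 11 := by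
    rw [f₅.arr 11, f₄.arr 11, f₃.arr 11, f₂.arr 11, f₁.arr 11]
  refine (vertexClauses_spec hc he₆ h₆.1 h30').mono le_rfl ?_
  intro τ₇ _ h₇
  refine h₇.mono (by omega) rfl rfl rfl fun x => ?_
  unfold Tables.Clauses
  rw [he₃.s, litHolds_of_lt hs, or_self, true_and, and_assoc, and_assoc, a11]
  refine and_congr_right fun _ => and_congr_right fun _ => and_congr_right fun _ => ?_
  refine forall₃_congr fun v hv _ => and_congr_right fun _ => ?_
  rw [h₆.2 v hv, a11, and_imp]

end RAM

namespace RAM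

open Prog

variable {c : Tables} {r : ℕ → ℕ → Prop}

/-! ### Deciding satisfiability -/

/-- Clear register `35` if the variable in register `31` is equivalent to its negation. -/
def checkVariable : Prog :=
  block [.copy 3 31, shortestWalks, block [.load 32 15 31, .load 33 3 32, .copy 3 32],
    shortestWalks, block [.load 34 3 31,
      .cond (.lt 33 26) (.cond (.lt 34 26) (.const 35 0) .skip) .skip]]

/-- Set register `0` to one if the clauses are satisfiable. -/
def checkSat : Prog :=
  block [block [.copy 1 26, .copy 35 28], forLoop 31 20 checkVariable,
    .cond (.eq 35 28) (.const 0 1) .skip]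

theorem checkVariable_spec {b v Z : ℕ} {Φ : (ℕ → Prop) → Prop} {σ : State}
    (he : Env c σ) (h : Implications c.n b Φ σ) (h1 : σ.reg 1 = 2 * c.n) (h31 : σ.reg 31 = v)
    (hv : v < c.n) (hb : b ≤ Z) (hn : 2 * c.n ≤ Z) :
    Wp checkVariable (60 * Z ^ 2) σ fun τ => τ.reg 35 =
      open scoped Classical in
      if Relation.ReflTransGen (EdgeRel (σ.reg 2) (σ.arr 1) (σ.arr 2)) v (c.n + v) ∧
        Relation.ReflTransGen (EdgeRel (σ.reg 2) (σ.arr 1) (σ.arr 2)) (c.n + v) v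
      then 0 else σ.reg 35 := by
  set R := EdgeRel (σ.reg 2) (σ.arr 1) (σ.arr 2) with hR
  have hRlt : ∀ a b, R a b → b < 2 * c.n := by
    rintro a b ⟨j, hj, -, rfl⟩
    exact (h.lt j hj).2
  have hZ : 1 ≤ Z ^ 2 := Nat.one_le_pow _ _ (by omega)
  have hcost : 1 + (25 * Z ^ 2 + (3 + (25 * Z ^ 2 + 6))) ≤ 60 * Z ^ 2 := by omega
  refine Wp.mono ?_ hcost fun _ _ h => h
  refine Wp.seq_eval rfl fun τ₁ e₁ f₁ => ?_
  have he₁ := he.frame f₁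
  have h3 : τ₁.reg 3 = v := by simp [e₁, eval, State.setReg_reg, h31]
  refine Wp.seq (shortestWalks_spec ((f₁.reg 1).trans h1) (f₁.reg 2) h3 (by omega)
    (by rw [f₁.arr 1, f₁.arr 2]; exact h.lt) hn (h.le.trans hb)) fun τ₂ f₂ h₂ => ?_
  rw [f₁.arr 1, f₁.arr 2, ← hR] at h₂
  have he₂ := he₁.frame f₂
  have r31 : τ₂.reg 31 = v := by rw [f₂.reg 31, f₁.reg 31, h31]
  refine Wp.seq_eval rfl fun τ₃ e₃ f₃ => ?_
  have he₃ := he₂.frame f₃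
  have hneg : τ₂.arr 15 v = c.n + v := by rw [he₂.neg v (by omega)]; simp [negLit, hv]
  have h3' : τ₃.reg 3 = c.n + v := by
    simp [e₃, eval, block, State.setReg_reg, r31, hneg]
  -- The second search overwrites array `3`, so the distance from `v` to its negation is kept in a
  -- register.
  have h33 : τ₃.reg 33 = τ₂.arr 3 (c.n + v) := by
    simp [e₃, eval, block, State.setReg_reg, r31, hneg]
  have a1 : τ₃.arr 1 = σ.arr 1 := by rw [f₃.arr 1, f₂.arr 1, f₁.arr 1]
  have a2 : τ₃.arr 2 = σ.arr 2 := by rw [f₃.arr 2, f₂.arr 2, f₁.arr 2]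
  refine Wp.seq (shortestWalks_spec (M := σ.reg 2) (N := 2 * c.n)
    (by rw [f₃.reg 1, f₂.reg 1, f₁.reg 1, h1]) (by rw [f₃.reg 2, f₂.reg 2, f₁.reg 2]) h3' (by omega)
    (by rw [a1, a2]; exact h.lt) hn (h.le.trans hb)) fun τ₄ f₄ h₄ => ?_
  rw [a1, a2, ← hR] at h₄
  have he₄ := he₃.frame f₄
  have r31' : τ₄.reg 31 = v := by rw [f₄.reg 31, f₃.reg 31, r31]
  refine Wp.of_loopFree rfl ?_
  have q1 := h₂.lt_iff hRlt (by omega) (show c.n + v < 2 * c.n by omega)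
  have q2 := h₄.lt_iff hRlt (by omega) (show v < 2 * c.n by omega)
  rw [← q1, ← q2]
  have r35 : τ₄.reg 35 = σ.reg 35 := by
    rw [f₄.reg 35, f₃.reg 35, f₂.reg 35, f₁.reg 35]
  have r33 : τ₄.reg 33 = τ₂.arr 3 (c.n + v) := by rw [f₄.reg 33, h33]
  by_cases c1 : τ₂.arr 3 (c.n + v) < 2 * c.n <;> by_cases c2 : τ₄.arr 3 v < 2 * c.n <;>
    simp [eval, block, State.setReg_reg, Test.Holds, r31', r33, r35, he₄.nn, c1, c2]

/-- A negative outcome leaves register `0` alone, so over successive calls the register accumulates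
the disjunction of the answers. -/
theorem checkSat_spec {b Z : ℕ} {Φ : (ℕ → Prop) → Prop} {σ : State}
    (he : Env c σ) (h : Implications c.n b Φ σ) (hb : b ≤ Z) (hn : 2 * c.n ≤ Z) (hZ : 1 ≤ Z) :
    Wp checkSat (69 * Z ^ 3) σ fun τ => τ.reg 0 =
      open scoped Classical in if ∃ x, Φ x then 1 else σ.reg 0 := by
  set R := EdgeRel (σ.reg 2) (σ.arr 1) (σ.arr 2) with hR
  have hsat : (∃ x, Φ x) ↔
      ∀ v < c.n, ¬ (Relation.ReflTransGen R v (c.n + v) ∧ Relation.ReflTransGen R (c.n + v) v) := by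
    rw [← exists_assignment_iff]
    · refine exists_congr fun x => ?_
      rw [← h.iff x]
      constructor
      · rintro hx a b ⟨j, hj, rfl, rfl⟩
        exact hx j hj
      · exact fun hx j hj => hx _ _ ⟨j, hj, rfl, rfl⟩
    · rintro a b ⟨j, hj, rfl, rfl⟩
      exact h.lt j hj
    · rintro a b ⟨j, hj, rfl, rfl⟩
      obtain ⟨i, hi, e1, e2⟩ := h.skew j hj
      exact ⟨i, hi, e1, e2⟩
  have hcost : 2 + ((2 + c.n * (60 * Z ^ 2 + 2)) + 3) ≤ 69 * Z ^ 3 := by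
    have := loop_bound (B := 60 * Z ^ 2) hZ (show c.n ≤ Z by omega) le_rfl
    have h1 : 1 ≤ Z ^ 3 := Nat.one_le_pow _ _ hZ
    simp only [show 2 + 1 = 3 from rfl] at this
    omega
  refine Wp.mono ?_ hcost fun _ _ h => h
  refine Wp.seq_eval rfl fun τ₁ e₁ f₁ => ?_
  have he₁ := he.frame f₁
  have r35 : τ₁.reg 35 = 1 := by simp [e₁, eval, block, State.setReg_reg, he.one]
  have r1 : τ₁.reg 1 = 2 * c.n := by simp [e₁, eval, block, State.setReg_reg, he.nn]
  have h₁ : Implications c.n b Φ τ₁ :=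
    h.mono le_rfl (f₁.reg 2) (f₁.arr 1) (f₁.arr 2) fun _ => Iff.rfl
  refine Wp.seq (Wp.forLoop (fun j τ => τ.reg 35 = 1 ↔ ∀ v < j,
      ¬ (Relation.ReflTransGen R v (c.n + v) ∧ Relation.ReflTransGen R (c.n + v) v))
      he₁.n rfl rfl (by decide) (by simp [State.setReg_reg, r35]) ?_) fun τ₂ f₂ h₂ => ?_
  · intro j hj τ hf hij hinv
    refine (checkVariable_spec (he₁.frame hf)
      (h₁.mono le_rfl (hf.reg 2) (hf.arr 1) (hf.arr 2) fun _ => Iff.rfl) ((hf.reg 1).trans r1)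
      hij hj hb hn).mono le_rfl ?_
    intro υ _ hυ
    have : EdgeRel (τ.reg 2) (τ.arr 1) (τ.arr 2) = R := by
      rw [hf.reg 2, hf.arr 1, hf.arr 2, f₁.reg 2, f₁.arr 1, f₁.arr 2]
    rw [this] at hυ
    rw [Nat.forall_lt_succ_right, ← hinv, State.setReg_reg, if_neg (by decide), hυ]
    split
    · rename_i h'
      exact iff_of_false (by decide) fun h => h.2 h'
    · rename_i h'
      exact ⟨fun h => ⟨h, h'⟩, fun h => h.1⟩
  · rw [← hsat] at h₂
    refine Wp.of_loopFree rfl ?_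
    have r0 : τ₂.reg 0 = σ.reg 0 := by rw [f₂.reg 0, f₁.reg 0]
    by_cases hx : τ₂.reg 35 = 1
    · simp [eval, block, Test.Holds, (he₁.frame f₂).one, hx, State.setReg_reg, h₂.1 hx]
    · simp [eval, block, Test.Holds, (he₁.frame f₂).one, hx, r0, show ¬ ∃ x, Φ x from fun h => hx (h₂.2 h)]

/-! ### Searching all selections of backward arcs -/

/-- Try all highest levels for the selection in array `11`. -/
def trySelection : Prog := forLoop 30 20 (.seq makeClauses checkSat)

/-- Advance the binary counter in array `11`, with the final carry in register `29`. -/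
def nextSelection : Prog :=
  .seq (.const 29 1) (forLoop 11 25 (.cond (.eq 29 28)
    (.seq (.load 12 11 11) (.cond (.eq 12 28) (.store 11 11 27)
      (.seq (.store 11 11 28) (.const 29 0)))) .skip))

/-- Try all selections. -/
def search : Prog := .loop (.eq 29 27) (.seq trySelection nextSelection)

theorem trySelection_spec (hc : c.Correct r) {Z : ℕ} {σ : State} (he : Env c σ)
    (hZ : 8 * (c.n + c.k + c.q) ≤ Z) :
    Wp trySelection (152 * Z ^ 4) σ fun τ => τ.reg 0 = open scoped Classical in
      if ∃ D < c.n, ∃ x, c.Clauses (fun i => σ.arr 11 i = 1) D x then 1 else σ.reg 0 := by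
  have hn0 : 0 < c.n := (Nat.zero_le _).trans_lt hc.s_lt
  have hZ1 : 1 ≤ Z := by omega
  have hcost : 2 + c.n * ((79 * Z + 69 * Z ^ 3) + 2) ≤ 152 * Z ^ 4 := by
    refine loop_bound (C := 148) (e := 3) hZ1 (by omega) ?_
    have : Z ≤ Z ^ 3 := Nat.le_self_pow (by decide) Z
    omega
  refine Wp.mono ?_ hcost fun _ _ h => h
  classical
  refine Wp.forLoop (fun j τ => τ.reg 0 =
    if ∃ D < j, ∃ x, c.Clauses (fun i => σ.arr 11 i = 1) D x then 1 else σ.reg 0)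
    he.n rfl rfl (by decide) (by simp [State.setReg_reg]) ?_
  intro j hj τ hf hij hinv
  have heτ := he.frame hf
  refine Wp.seq (makeClauses_spec hc heτ hij (by omega) (by omega) (by omega)) fun υ fυ hυ => ?_
  refine (checkSat_spec (heτ.frame fυ) hυ (show _ ≤ Z by omega) (by omega) hZ1).mono le_rfl ?_
  intro ρ _ hρ
  rw [State.setReg_reg, if_neg (by decide), hρ, fυ.reg 0, hinv, hf.arr 11]
  have : (∃ D < j + 1, ∃ x, c.Clauses (fun i => σ.arr 11 i = 1) D x) ↔
      (∃ x, c.Clauses (fun i => σ.arr 11 i = 1) j x) ∨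
      ∃ D < j, ∃ x, c.Clauses (fun i => σ.arr 11 i = 1) D x := by
    rw [Nat.exists_lt_succ_right, or_comm]
  simp only [this]
  by_cases h1 : ∃ x, c.Clauses (fun i => σ.arr 11 i = 1) j x
  · rw [if_pos h1, if_pos (.inl h1)]
  · rw [if_neg h1]; simp only [h1, false_or]

/-- The carry reaches position `j` exactly when all lower bits of `a` are one, that is, when `2 ^ j`
divides `a + 1`. -/
theorem testBit_succ (a j : ℕ) :
    (a + 1).testBit j = if 2 ^ j ∣ a + 1 then !a.testBit j else a.testBit j := by
  simp only [Nat.testBit_eq_decide_div_mod_eq, Nat.succ_div]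
  split
  · rcases Nat.mod_two_eq_zero_or_one (a / 2 ^ j) with h | h <;> simp [Nat.add_mod, h]
  · simp

/-- The carry is passed on from position `j` exactly when it arrives there and finds a one. -/
theorem pow_succ_dvd_succ_iff (a j : ℕ) :
    2 ^ (j + 1) ∣ a + 1 ↔ 2 ^ j ∣ a + 1 ∧ a.testBit j = true := by
  constructor
  · intro h
    have h1 : 2 ^ j ∣ a + 1 := (pow_dvd_pow 2 (Nat.le_succ j)).trans h
    refine ⟨h1, ?_⟩
    have h2 := testBit_succ a j
    rw [if_pos h1] at h2
    obtain ⟨q, hq⟩ := h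
    have h3 : (a + 1).testBit j = false := by
      rw [Nat.testBit_eq_decide_div_mod_eq, hq, pow_succ, mul_assoc,
        Nat.mul_div_cancel_left _ (by positivity)]
      simp
    rw [h3] at h2
    simpa using h2.symm
  · rintro ⟨h1, h2⟩
    have h3 := testBit_succ a j
    rw [if_pos h1, h2, Nat.testBit_eq_decide_div_mod_eq] at h3
    simp only [Bool.not_true, decide_eq_false_iff_not] at h3
    rw [pow_succ]
    obtain ⟨q, hq⟩ := h1
    rw [hq] at h3 ⊢
    rw [Nat.mul_div_cancel_left _ (by positivity)] at h3
    exact Nat.mul_dvd_mul_left _ (by omega)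

theorem nextSelection_spec {a : ℕ} {σ : State} (he : Env c σ)
    (h : ∀ i < c.k, σ.arr 11 i = if a.testBit i then 1 else 0) :
    Wp nextSelection (1 + (2 + c.k * (7 + 2))) σ fun τ =>
      (∀ i < c.k, τ.arr 11 i = if (a + 1).testBit i then 1 else 0) ∧
        τ.reg 29 = if 2 ^ c.k ∣ a + 1 then 1 else 0 := by
  refine Wp.seq_eval rfl fun τ₁ e₁ f₁ => ?_
  have he₁ := he.frame f₁
  have r29 : τ₁.reg 29 = 1 := by simp [e₁, eval, State.setReg_reg]
  refine (Wp.forLoop (fun j τ => (∀ i < c.k, τ.arr 11 i =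
      if (if i < j then (a + 1).testBit i else a.testBit i) then 1 else 0) ∧
      τ.reg 29 = if 2 ^ j ∣ a + 1 then 1 else 0) he₁.k rfl rfl (by decide) ?_ ?_).mono le_rfl ?_
  · refine ⟨?_, by simp [State.setReg_reg, r29]⟩
    rw [State.setReg_arr, f₁.arr 11]
    simpa using h
  · rintro j hj τ hf hij ⟨h1, h2⟩
    have heτ := he₁.frame hf
    have hjv : τ.arr 11 j = if a.testBit j then 1 else 0 := by simpa using h1 j hj
    refine (Wp.of_loopFree (p := .cond (.eq 29 28)
      (.seq (.load 12 11 11) (.cond (.eq 12 28) (.store 11 11 27)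
      (.seq (.store 11 11 28) (.const 29 0)))) .skip) (Q := fun υ => (υ.arr 11 =
        if 2 ^ j ∣ a + 1 then Function.update (τ.arr 11) j (if a.testBit j then 0 else 1)
        else τ.arr 11) ∧ υ.reg 29 = if 2 ^ (j + 1) ∣ a + 1 then 1 else 0) rfl ?_).mono
      (by decide) ?_
    · simp only [pow_succ_dvd_succ_iff]
      by_cases hd : 2 ^ j ∣ a + 1 <;> by_cases ht : a.testBit j = true <;>
        simp [eval, Test.Holds, State.setReg_reg, State.setArr_arr, hij, heτ.one, heτ.zero, h2, hd,
          hjv, ht]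
    · rintro υ - ⟨h3, h4⟩
      refine ⟨?_, by simpa [State.setReg_reg] using h4⟩
      intro i hi
      rw [State.setReg_arr, h3]
      by_cases hij' : i = j
      · subst hij'
        have := testBit_succ a i
        by_cases hd : 2 ^ i ∣ a + 1
        · rw [if_pos hd] at this
          simp only [hd, if_true, Function.update_self, this, Nat.lt_succ_self]
          cases a.testBit i <;> simp
        · rw [if_neg hd] at this
          simp only [hd, if_false, hjv, this, Nat.lt_succ_self, if_true]
      · have e1 : (i < j + 1) = (i < j) := by
          apply propext; omega
        simp only [e1]
        rw [← h1 i hi]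
        split <;> simp [hij']
  · rintro τ - ⟨h1, h2⟩
    refine ⟨fun i hi => ?_, h2⟩
    rw [h1 i hi, if_pos hi]

theorem _root_.Tables.clauses_congr {bits bits' : ℕ → Prop} (h : ∀ i < c.k, bits i ↔ bits' i)
    (D : ℕ) (x : ℕ → Prop) : c.Clauses bits D x ↔ c.Clauses bits' D x := by
  unfold Tables.Clauses
  have e1 : (∀ i < c.k, bits i → x (c.bh i)) ↔ ∀ i < c.k, bits' i → x (c.bh i) :=
    forall₂_congr fun i hi => by rw [h i hi]
  have e2 : ∀ v, (∀ i < c.k, bits i → c.bt i ≠ v) ↔ ∀ i < c.k, bits' i → c.bt i ≠ v :=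
    fun v => forall₂_congr fun i hi => by rw [h i hi]
  simp only [e1, e2]

theorem exists_testBit (bits : ℕ → Prop) (k : ℕ) :
    ∃ a < 2 ^ k, ∀ i < k, a.testBit i = true ↔ bits i := by
  classical
  refine ⟨Nat.ofBits fun i : Fin k => decide (bits i), Nat.ofBits_lt_two_pow _, fun i hi => ?_⟩
  rw [Nat.testBit_ofBits_lt _ _ hi]
  simp

/-- All `2 ^ k` values of the counter are tried, without early exit; the overflow carry in register
`29` ends the loop. -/
theorem search_spec (hc : c.Correct r) {Z : ℕ} {σ : State} (he : Env c σ)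
    (hZ : 8 * (c.n + c.k + c.q) ≤ Z) (h0 : σ.reg 0 = 0) (h29 : σ.reg 29 = 0)
    (h11 : ∀ i < c.k, σ.arr 11 i = 0) :
    Wp search (2 ^ c.k * (170 * Z ^ 4)) σ fun τ => τ.reg 0 = open scoped Classical in
      if c.Safe r then 1 else 0 := by
  have hn0 : 0 < c.n := (Nat.zero_le _).trans_lt hc.s_lt
  have hZ1 : 1 ≤ Z := by omega
  have hcost : 1 + 2 ^ c.k * ((152 * Z ^ 4 + (1 + (2 + c.k * (7 + 2)))) + 1) ≤
      2 ^ c.k * (170 * Z ^ 4) := by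
    have h1 : Z ≤ Z ^ 4 := Nat.le_self_pow (by decide) Z
    have h2 : 1 ≤ 2 ^ c.k := Nat.one_le_two_pow
    calc _ ≤ 2 ^ c.k * 1 + 2 ^ c.k * ((152 * Z ^ 4 + (1 + (2 + c.k * (7 + 2)))) + 1) := by omega
      _ = 2 ^ c.k * (1 + ((152 * Z ^ 4 + (1 + (2 + c.k * (7 + 2)))) + 1)) := by ring
      _ ≤ _ := Nat.mul_le_mul_left _ (by omega)
  classical
  refine (Wp.loop (N := 2 ^ c.k) (fun a τ => (τ.reg 0 = if ∃ a' < a, ∃ D < c.n, ∃ x,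
      c.Clauses (fun i => a'.testBit i = true) D x then 1 else 0) ∧
      (∀ i < c.k, τ.arr 11 i = if a.testBit i then 1 else 0) ∧
      τ.reg 29 = if a < 2 ^ c.k then 0 else 1) ?_ ?_ ?_).mono hcost ?_
  · refine ⟨by simp [h0], by simpa using h11, by simp [h29]⟩
  · rintro a ha τ hf ⟨h1, h2, h3⟩
    have heτ := he.frame hf
    refine ⟨by simp [Test.Holds, heτ.zero, h3, ha], ?_⟩
    refine Wp.seq (trySelection_spec hc heτ hZ) fun υ fυ hυ => ?_
    refine (nextSelection_spec (a := a) (heτ.frame fυ) (by rw [fυ.arr 11]; exact h2)).mono le_rfl ?_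
    rintro ρ fρ ⟨h4, h5⟩
    refine ⟨?_, h4, ?_⟩
    · rw [fρ.reg 0, hυ, h1]
      have e1 : ∀ D x, c.Clauses (fun i => τ.arr 11 i = 1) D x ↔
          c.Clauses (fun i => a.testBit i = true) D x := by
        refine Tables.clauses_congr fun i hi => ?_
        rw [h2 i hi]
        cases a.testBit i <;> simp
      simp only [e1, Nat.exists_lt_succ_right]
      by_cases h6 : ∃ D < c.n, ∃ x, c.Clauses (fun i => a.testBit i = true) D x
      · rw [if_pos h6, if_pos (.inr h6)]
      · simp only [h6, if_false, or_false]
    · rw [h5]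
      -- As `a < 2 ^ c.k`, divisibility can only mean `a + 1 = 2 ^ c.k`.
      have : 2 ^ c.k ∣ a + 1 ↔ ¬ a + 1 < 2 ^ c.k :=
        ⟨fun h => not_lt.2 (Nat.le_of_dvd (by omega) h), fun h => by
          rw [show a + 1 = 2 ^ c.k by omega]⟩
      by_cases h6 : a + 1 < 2 ^ c.k <;> simp [this, h6]
  · rintro τ hf ⟨-, -, h3⟩
    simp [Test.Holds, (he.frame hf).zero, h3]
  · rintro τ - ⟨h1, -, -⟩
    rw [h1]
    refine if_congr ?_ rfl rfl
    constructor
    -- A satisfying assignment for any guess yields a safe path; completeness needs the guess read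
    -- off the path, whose bits form a number below `2 ^ c.k`.
    · rintro ⟨a, -, D, -, x, hx⟩
      exact hc.safe_of_clauses hx
    · intro hs
      obtain ⟨bits, D, hD, x, hx⟩ := hc.exists_clauses hs
      obtain ⟨a, ha, hbits⟩ := exists_testBit bits c.k
      exact ⟨a, ha, D, hD, x, (Tables.clauses_congr hbits D x).2 hx⟩

end RAM

namespace RAM

open Prog

/-! ### Computing the tables -/

/-- Levels of the vertices, to array `4`. -/
def distTable : Prog :=
  block [block [.copy 1 20, .copy 2 23, .copy 3 21], shortestWalks,
    forLoop 11 20 (block [.load 12 3 11, .store 4 11 12])]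

/-- Complementary literals, to array `15`. -/
def negTable : Prog :=
  .seq (block [.const 28 1, .copy 26 20])
    (forLoop 11 20 (block [.store 15 11 26, .store 15 26 11, .succ 26]))

/-- Backward arcs, to arrays `9` and `10`. -/
def backTable : Prog :=
  .seq (.const 25 0) (forLoop 11 23 (block [.load 12 1 11, .load 13 2 11, .load 14 4 12,
    .load 15 4 13, .cond (.lt 14 20) (.cond (.lt 15 14)
      (block [.store 9 25 12, .store 10 25 13, .succ 25]) .skip) .skip]))

/-- The other vertices of the levels, to array `5`. -/
def mateTable : Prog :=
  forLoop 11 20 (block [block [.copy 12 11, .load 14 4 11],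
    forLoop 13 20 (block [.load 15 4 13,
      .cond (.eq 14 15) (.cond (.eq 13 11) .skip (.copy 12 13)) .skip]),
    .store 5 11 12])

/-- Out-neighbours in the same and in the next level, to arrays `6`, `7` and `8`. -/
def litTable : Prog :=
  .seq (forLoop 11 20 (block [.load 12 15 11, .store 6 11 12, .store 7 11 12, .const 13 0,
      .store 8 11 13]))
    (forLoop 11 23 (block [.load 12 1 11, .load 13 2 11, .load 14 4 12, .load 15 4 13,
      .cond (.eq 14 15) (.store 6 12 13) .skip, .succ 14,
      .cond (.eq 14 15) (block [.load 16 5 13, .load 17 7 12,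
        .cond (.eq 16 17) (.store 8 12 28) .skip, .store 7 12 13]) .skip]))

/-! ### Correctness and cost of the table computations -/

theorem distTable_spec {n m s Z : ℕ} {σ : State} (hn : σ.reg 20 = n) (hm : σ.reg 23 = m)
    (hs : σ.reg 21 = s) (hsn : s < n) (hlt : ∀ j < m, σ.arr 1 j < n ∧ σ.arr 2 j < n)
    (hnZ : n ≤ Z) (hmZ : m ≤ Z) :
    Wp distTable (34 * Z ^ 2) σ fun τ =>
      IsDist (EdgeRel m (σ.arr 1) (σ.arr 2)) n s (τ.arr 4) := by
  have hb : 3 + (25 * Z ^ 2 + (2 + n * (2 + 2))) ≤ 34 * Z ^ 2 := by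
    have : Z ≤ Z ^ 2 := Nat.le_self_pow (by decide) Z
    omega
  refine Wp.mono ?_ hb fun _ _ h => h
  refine Wp.seq_eval rfl fun τ₁ e₁ f₁ => ?_
  have r1 : τ₁.reg 1 = n := by simp [e₁, eval, block, State.setReg_reg, hn]
  have r2 : τ₁.reg 2 = m := by simp [e₁, eval, block, State.setReg_reg, hm]
  have r3 : τ₁.reg 3 = s := by simp [e₁, eval, block, State.setReg_reg, hs]
  refine Wp.seq (shortestWalks_spec r1 r2 r3 hsn (by rw [f₁.arr 1, f₁.arr 2]; exact hlt) hnZ hmZ)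
    fun τ₂ f₂ h₂ => ?_
  rw [f₁.arr 1, f₁.arr 2] at h₂
  refine (Wp.forLoop (fun j τ => ∀ i < j, τ.arr 4 i = τ₂.arr 3 i)
    (by rw [f₂.reg 20, f₁.reg 20, hn]) rfl rfl (by decide) (by simp) ?_).mono le_rfl ?_
  · intro j hj τ hf hij hinv
    refine Wp.of_loopFree rfl ?_
    intro i hi
    simp only [eval, block, State.setReg_arr, State.setArr_arr, State.setReg_reg, hij, hf.arr 3]
    by_cases hvl : i = j
    · subst hvl; simp
    · simpa [hvl] using hinv i (by omega)
  · intro τ _ h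
    exact ⟨fun v hv => by rw [h v hv]; exact h₂.le v hv,
      fun v hv => by rw [h v hv]; exact h₂.walk v hv,
      fun v hv => by rw [h v hv]; exact h₂.min v hv⟩

/-- Register `26` runs through the negative literals from `n` upwards and so ends at `2 * n`, the
number of literals needed later. -/
theorem negTable_spec {n : ℕ} {σ : State} (hn : σ.reg 20 = n) :
    Wp negTable (2 + (2 + n * (3 + 2))) σ fun τ => τ.reg 28 = 1 ∧ τ.reg 26 = 2 * n ∧
      ∀ l < 2 * n, τ.arr 15 l = negLit n l := by
  refine Wp.seq_eval rfl fun τ₁ e₁ f₁ => ?_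
  have r28 : τ₁.reg 28 = 1 := by simp [e₁, eval, block, State.setReg_reg]
  have r26 : τ₁.reg 26 = n := by simp [e₁, eval, block, State.setReg_reg, hn]
  refine (Wp.forLoop (fun j τ => τ.reg 26 = n + j ∧
      ∀ i < j, τ.arr 15 i = n + i ∧ τ.arr 15 (n + i) = i)
    (by rw [f₁.reg 20, hn]) rfl rfl (by decide) (by simp [State.setReg_reg, r26]) ?_).mono le_rfl ?_
  · rintro j hj τ hf hij ⟨h1, h2⟩
    refine Wp.of_loopFree rfl ?_
    simp only [eval, block, State.setReg_arr, State.setArr_arr, State.setReg_reg, hij, if_true,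
      State.setArr_reg, h1]
    refine ⟨by simp; omega, ?_⟩
    intro i hi
    have e1 : n + j ≠ j := by omega
    by_cases hij' : i = j
    · subst hij'
      rw [Function.update_of_ne (by omega)]
      simp
    · obtain ⟨h3, h4⟩ := h2 i (by omega)
      rw [Function.update_of_ne (by omega), Function.update_of_ne (by omega),
        Function.update_of_ne (by omega), Function.update_of_ne (by omega)]
      exact ⟨h3, h4⟩
  · rintro τ hf ⟨h1, h2⟩
    refine ⟨(hf.reg 28).trans r28, by omega, ?_⟩
    intro l hl
    unfold negLit
    split
    · rename_i h; exact (h2 l h).1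
    · rename_i h
      have := (h2 (l - n) (by omega)).2
      rwa [show n + (l - n) = l by omega] at this

/-- The arc is backward with respect to the levels `δ`. -/
def IsBack (n : ℕ) (δ T H : ℕ → ℕ) (j : ℕ) : Prop := δ (T j) < n ∧ δ (H j) < δ (T j)

-- The number of recorded arcs is stated as a cardinality so that it can be compared with the number
-- of backward arcs of the instance, which governs the exponent.
open scoped Classical in
theorem backTable_spec {n m : ℕ} {δ T H : ℕ → ℕ} {σ : State} (hn : σ.reg 20 = n)
    (hm : σ.reg 23 = m) (hT : σ.arr 1 = T) (hH : σ.arr 2 = H) (hδ : σ.arr 4 = δ) :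
    Wp backTable (1 + (2 + m * (11 + 2))) σ fun τ =>
      τ.reg 25 = ((Finset.range m).filter (IsBack n δ T H)).card ∧
      (∀ i < τ.reg 25, ∃ j < m, τ.arr 9 i = T j ∧ τ.arr 10 i = H j) ∧
      ∀ j < m, IsBack n δ T H j → ∃ i < τ.reg 25, τ.arr 9 i = T j ∧ τ.arr 10 i = H j := by
  refine Wp.seq_eval rfl fun τ₁ e₁ f₁ => ?_
  have r25 : τ₁.reg 25 = 0 := by simp [e₁, eval, State.setReg_reg]
  refine Wp.forLoop (fun l τ =>
      τ.reg 25 = ((Finset.range l).filter (IsBack n δ T H)).card ∧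
      (∀ i < τ.reg 25, ∃ j < m, τ.arr 9 i = T j ∧ τ.arr 10 i = H j) ∧
      ∀ j < l, IsBack n δ T H j → ∃ i < τ.reg 25, τ.arr 9 i = T j ∧ τ.arr 10 i = H j)
    (by rw [f₁.reg 23, hm]) rfl rfl (by decide) (by simp [State.setReg_reg, r25]) ?_
  rintro l hl τ hf hij ⟨h1, h2, h3⟩
  have b1 : τ.arr 1 = T := by rw [hf.arr 1, f₁.arr 1, hT]
  have b2 : τ.arr 2 = H := by rw [hf.arr 2, f₁.arr 2, hH]
  have b4 : τ.arr 4 = δ := by rw [hf.arr 4, f₁.arr 4, hδ]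
  have b20 : τ.reg 20 = n := by rw [hf.reg 20, f₁.reg 20, hn]
  refine (Wp.of_loopFree (p := block [.load 12 1 11, .load 13 2 11, .load 14 4 12,
    .load 15 4 13, .cond (.lt 14 20) (.cond (.lt 15 14)
      (block [.store 9 25 12, .store 10 25 13, .succ 25]) .skip) .skip])
    (Q := fun υ => (υ.reg 25 = if IsBack n δ T H l then τ.reg 25 + 1 else τ.reg 25) ∧
      (υ.arr 9 = if IsBack n δ T H l then Function.update (τ.arr 9) (τ.reg 25) (T l)
        else τ.arr 9) ∧
      (υ.arr 10 = if IsBack n δ T H l then Function.update (τ.arr 10) (τ.reg 25) (H l)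
        else τ.arr 10)) rfl ?_).mono (by decide) ?_
  · unfold IsBack
    by_cases c1 : δ (T l) < n <;> by_cases c2 : δ (H l) < δ (T l) <;>
      simp [eval, block, Test.Holds, State.setReg_reg, State.setArr_arr, hij, b1, b2, b4, b20,
        c1, c2]
  · rintro υ - ⟨k1, k2, k3⟩
    simp only [State.setReg_reg, State.setReg_arr]
    rw [if_neg (by decide)]
    by_cases hb : IsBack n δ T H l
    · rw [if_pos hb] at k1 k2 k3
      have hold : ∀ i < τ.reg 25, υ.arr 9 i = τ.arr 9 i ∧ υ.arr 10 i = τ.arr 10 i := by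
        intro i hi
        rw [k2, k3, Function.update_of_ne (by omega), Function.update_of_ne (by omega)]
        exact ⟨rfl, rfl⟩
      have hnew : υ.arr 9 (τ.reg 25) = T l ∧ υ.arr 10 (τ.reg 25) = H l := by simp [k2, k3]
      refine ⟨?_, ?_, ?_⟩
      · rw [k1, h1, Finset.range_add_one, Finset.filter_insert, if_pos hb,
          Finset.card_insert_of_notMem (by simp)]
      · intro i hi
        rw [k1] at hi
        rcases Nat.lt_succ_iff_lt_or_eq.1 hi with hi | rfl
        · rw [(hold i hi).1, (hold i hi).2]; exact h2 i hi
        · exact ⟨l, hl, hnew⟩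
      · intro j hj hbj
        rcases Nat.lt_succ_iff_lt_or_eq.1 hj with hj | rfl
        · obtain ⟨i, hi, e⟩ := h3 j hj hbj
          exact ⟨i, by omega, by rw [(hold i hi).1, (hold i hi).2]; exact e⟩
        · exact ⟨τ.reg 25, by omega, hnew⟩
    · rw [if_neg hb] at k1 k2 k3
      rw [k1, k2, k3]
      refine ⟨?_, h2, ?_⟩
      · rw [h1, Finset.range_add_one, Finset.filter_insert, if_neg hb]
      · intro j hj hbj
        rcases Nat.lt_succ_iff_lt_or_eq.1 hj with hj | rfl
        · exact h3 j hj hbj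
        · exact absurd hbj hb

/-- Nothing is assumed about the width here. The scan finds some other vertex of the level if there
is one; width two later makes it the only one. -/
theorem mateTable_spec {n Z : ℕ} {δ : ℕ → ℕ} {σ : State} (hn : σ.reg 20 = n)
    (hδ : σ.arr 4 = δ) (hnZ : n ≤ Z) (hZ : 1 ≤ Z) :
    Wp mateTable (19 * Z ^ 2) σ fun τ => ∀ v < n, τ.arr 5 v < n ∧ δ (τ.arr 5 v) = δ v ∧
      ∀ u < n, δ u = δ v → u ≠ v → τ.arr 5 v ≠ v := by
  have hb : 2 + n * ((2 + ((2 + n * (6 + 2)) + 1)) + 2) ≤ 19 * Z ^ 2 := by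
    have h1 : n * n ≤ Z * Z := Nat.mul_le_mul hnZ hnZ
    have h2 : Z ≤ Z * Z := Nat.le_mul_of_pos_left _ hZ
    nlinarith
  refine Wp.mono ?_ hb fun _ _ h => h
  refine Wp.forLoop (fun l τ => ∀ v < l, τ.arr 5 v < n ∧ δ (τ.arr 5 v) = δ v ∧
      ∀ u < n, δ u = δ v → u ≠ v → τ.arr 5 v ≠ v) hn rfl rfl (by decide) (by simp) ?_
  intro l hl τ hf hij hinv
  refine Wp.seq_eval rfl fun τ₁ e₁ f₁ => ?_
  have r12 : τ₁.reg 12 = l := by simp [e₁, eval, block, State.setReg_reg, hij]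
  have r14 : τ₁.reg 14 = δ l := by
    simp [e₁, eval, block, State.setReg_reg, hij, hf.arr 4, hδ]
  refine Wp.seq (Wp.forLoop (fun i υ => υ.reg 12 < n ∧ δ (υ.reg 12) = δ l ∧
      ∀ u < i, δ u = δ l → u ≠ l → υ.reg 12 ≠ l) (by rw [f₁.reg 20, hf.reg 20, hn]) rfl rfl
      (by decide) (by simp [State.setReg_reg, r12, hl]) ?_) fun τ₂ f₂ h₂ => ?_
  · rintro i hi υ fυ hii ⟨h1, h2, h3⟩
    have s14 : υ.reg 14 = δ l := (fυ.reg 14).trans r14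
    have s11 : υ.reg 11 = l := by rw [fυ.reg 11, f₁.reg 11, hij]
    have s4 : υ.arr 4 = δ := by rw [fυ.arr 4, f₁.arr 4, hf.arr 4, hδ]
    refine (Wp.of_loopFree (Q := fun ρ => ρ.reg 12 =
      if δ l = δ i ∧ i ≠ l then i else υ.reg 12) rfl ?_).mono (by decide) ?_
    · by_cases c1 : δ l = δ i <;> by_cases c2 : i = l <;>
        simp [eval, block, Test.Holds, State.setReg_reg, hii, s14, s11, s4, c1, c2]
    · intro ρ _ hρ
      simp only [State.setReg_reg]
      rw [if_neg (by decide), hρ]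
      split
      · rename_i hc
        exact ⟨by omega, hc.1.symm, fun _ _ _ _ => hc.2⟩
      · rename_i hc
        refine ⟨h1, h2, fun u hu hd hne => ?_⟩
        rcases Nat.lt_succ_iff_lt_or_eq.1 hu with hu | rfl
        · exact h3 u hu hd hne
        · exact absurd ⟨hd.symm, hne⟩ hc
  · refine Wp.of_loopFree rfl ?_
    have s11 : τ₂.reg 11 = l := by rw [f₂.reg 11, f₁.reg 11, hij]
    have s5 : τ₂.arr 5 = τ.arr 5 := by rw [f₂.arr 5, f₁.arr 5]
    intro v hv
    simp only [eval, block, State.setReg_arr, State.setArr_arr, if_true, s11, s5]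
    by_cases hvl : v = l
    · subst hvl; simpa using h₂
    · rw [Function.update_of_ne hvl]
      exact hinv v (by omega)

/-- The tables of out-neighbours are correct as far as the first `j` arcs are concerned. -/
def LitsUpTo (n m : ℕ) (δ T H mate : ℕ → ℕ) (j : ℕ) (f₁ f₂ f₃ : ℕ → ℕ) : Prop :=
  ∀ v < n, δ v < n →
    ((f₁ v = n + v ∧ ∀ i < j, T i = v → δ (H i) ≠ δ v) ∨
      (EdgeRel m T H v (f₁ v) ∧ δ (f₁ v) = δ v)) ∧
    ((f₂ v = n + v ∧ ∀ i < j, T i = v → δ (H i) ≠ δ v + 1) ∨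
      (EdgeRel m T H v (f₂ v) ∧ δ (f₂ v) = δ v + 1)) ∧
    (f₃ v = 0 → ∀ i < j, T i = v → δ (H i) = δ v + 1 → H i = f₂ v) ∧
    (f₃ v ≠ 0 → ∃ w, EdgeRel m T H v w ∧ EdgeRel m T H v (mate w) ∧ δ w = δ v + 1)

/-- A second out-neighbour in the next level must be the mate of the recorded one. This is the
moment at which the vertex is declared full; the newer out-neighbour then replaces the older one. -/
theorem LitsUpTo.step {n m : ℕ} {δ T H mate : ℕ → ℕ} {j : ℕ} {f₁ f₂ f₃ : ℕ → ℕ}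
    (hlt : ∀ j < m, T j < n ∧ H j < n)
    (hδ : ∀ j < m, δ (T j) < n → δ (H j) < n)
    (hmate : ∀ v < n, δ v < n → mate v < n ∧ ∀ u < n, δ u = δ v → u = v ∨ u = mate v)
    (h : LitsUpTo n m δ T H mate j f₁ f₂ f₃) (hj : j < m) :
    LitsUpTo n m δ T H mate (j + 1)
      (if δ (T j) = δ (H j) then Function.update f₁ (T j) (H j) else f₁)
      (if δ (T j) + 1 = δ (H j) then Function.update f₂ (T j) (H j) else f₂)
      (if δ (T j) + 1 = δ (H j) ∧ mate (H j) = f₂ (T j) then Function.update f₃ (T j) 1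
        else f₃) := by
  intro v hv hdv
  obtain ⟨h1, h2, h3, h4⟩ := h v hv hdv
  by_cases hvj : v = T j
  · subst hvj
    have hedge : EdgeRel m T H (T j) (H j) := ⟨j, hj, rfl, rfl⟩
    have hwn := (hlt j hj).2
    have hwd := hδ j hj hdv
    refine ⟨?_, ?_, ?_, ?_⟩
    · split
      · rename_i e
        right; simpa using ⟨hedge, e.symm⟩
      · rename_i e
        refine h1.imp (fun k => ⟨k.1, fun i hi ht => ?_⟩) id
        rcases Nat.lt_succ_iff_lt_or_eq.1 hi with hi | rfl
        · exact k.2 i hi ht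
        · exact fun k => e k.symm
    · split
      · rename_i e
        right; simpa using ⟨hedge, e.symm⟩
      · rename_i e
        refine h2.imp (fun k => ⟨k.1, fun i hi ht => ?_⟩) id
        rcases Nat.lt_succ_iff_lt_or_eq.1 hi with hi | rfl
        · exact k.2 i hi ht
        · exact fun k => e k.symm
    · intro hz i hi ht hd
      split at hz
      · simp at hz
      · rename_i hno
        rcases Nat.lt_succ_iff_lt_or_eq.1 hi with hi | rfl
        · have hold := h3 hz i hi ht hd
          split
          · rename_i e
            simp only [Function.update_self]
            -- The earlier out-neighbour is `H j` itself or its mate; the latter would have set the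
            -- mark.
            rcases (hmate _ hwn hwd).2 (H i) (hlt i (by omega)).2 (by omega) with k | k
            · exact k
            · exact absurd ⟨e, by rw [← hold, k]⟩ hno
          · exact hold
        · rw [if_pos hd.symm]; simp
    · intro hz
      split at hz
      · rename_i hyes
        refine ⟨H j, hedge, ?_, hyes.1.symm⟩
        rw [hyes.2]
        -- The recorded entry is a mate, hence a vertex below `n`, so it is not the default literal
        -- `n + v`.
        rcases h2 with k | k
        · have := (hmate _ hwn hwd).1
          omega
        · exact k.1
      · exact h4 hz
  · have u1 : (if δ (T j) = δ (H j) then Function.update f₁ (T j) (H j) else f₁) v = f₁ v := by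
      split <;> simp [hvj]
    have u2 : (if δ (T j) + 1 = δ (H j) then Function.update f₂ (T j) (H j) else f₂) v = f₂ v := by
      split <;> simp [hvj]
    have u3 : (if δ (T j) + 1 = δ (H j) ∧ mate (H j) = f₂ (T j) then Function.update f₃ (T j) 1
        else f₃) v = f₃ v := by
      split <;> simp [hvj]
    rw [u1, u2, u3]
    have hT : ∀ i < j + 1, T i = v → i < j := by
      intro i hi ht
      rcases Nat.lt_succ_iff_lt_or_eq.1 hi with hi | rfl
      · exact hi
      · exact absurd ht.symm hvj
    exact ⟨h1.imp (fun k => ⟨k.1, fun i hi ht => k.2 i (hT i hi ht) ht⟩) id,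
      h2.imp (fun k => ⟨k.1, fun i hi ht => k.2 i (hT i hi ht) ht⟩) id,
      fun hz i hi ht => h3 hz i (hT i hi ht) ht, h4⟩

theorem litTable_spec {n m : ℕ} {δ T H mate : ℕ → ℕ} {σ : State} (hn : σ.reg 20 = n)
    (hm : σ.reg 23 = m) (hone : σ.reg 28 = 1) (hT : σ.arr 1 = T) (hH : σ.arr 2 = H)
    (hd : σ.arr 4 = δ) (hmt : σ.arr 5 = mate) (hneg : ∀ l < 2 * n, σ.arr 15 l = negLit n l)
    (hlt : ∀ j < m, T j < n ∧ H j < n) (hδ : ∀ j < m, δ (T j) < n → δ (H j) < n)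
    (hmate : ∀ v < n, δ v < n → mate v < n ∧ ∀ u < n, δ u = δ v → u = v ∨ u = mate v) :
    Wp litTable ((2 + n * (5 + 2)) + (2 + m * (16 + 2))) σ fun τ =>
      LitsUpTo n m δ T H mate m (τ.arr 6) (τ.arr 7) (τ.arr 8) := by
  refine Wp.seq (Wp.forLoop (fun l τ => ∀ v < l, τ.arr 6 v = n + v ∧ τ.arr 7 v = n + v ∧
    τ.arr 8 v = 0) hn rfl rfl (by decide) (by simp) ?_) fun τ₁ f₁ h₁ => ?_
  · intro l hl τ hf hij hinv
    refine Wp.of_loopFree rfl ?_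
    intro v hv
    have hl15 : τ.arr 15 l = n + l := by
      rw [hf.arr 15, hneg l (by omega)]; simp [negLit, hl]
    simp only [eval, block, State.setReg_arr, State.setArr_arr, State.setReg_reg, hij,
      State.setArr_reg]
    by_cases hvl : v = l
    · subst hvl; simp [hl15]
    · simpa [hvl] using hinv v (by omega)
  · refine Wp.forLoop (fun j τ => LitsUpTo n m δ T H mate j (τ.arr 6) (τ.arr 7) (τ.arr 8))
      (by rw [f₁.reg 23, hm]) rfl rfl (by decide) ?_ ?_
    · intro v hv _
      obtain ⟨k1, k2, k3⟩ := h₁ v hv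
      simp only [State.setReg_arr]
      exact ⟨.inl ⟨k1, by simp⟩, .inl ⟨k2, by simp⟩, by simp, fun k => absurd k3 k⟩
    · intro j hj τ hf hij hinv
      have b1 : τ.arr 1 = T := by rw [hf.arr 1, f₁.arr 1, hT]
      have b2 : τ.arr 2 = H := by rw [hf.arr 2, f₁.arr 2, hH]
      have b4 : τ.arr 4 = δ := by rw [hf.arr 4, f₁.arr 4, hd]
      have b5 : τ.arr 5 = mate := by rw [hf.arr 5, f₁.arr 5, hmt]
      have b28 : τ.reg 28 = 1 := by rw [hf.reg 28, f₁.reg 28, hone]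
      have := hinv.step hlt hδ hmate hj
      refine (Wp.of_loopFree (p := block [.load 12 1 11, .load 13 2 11, .load 14 4 12,
        .load 15 4 13, .cond (.eq 14 15) (.store 6 12 13) .skip, .succ 14,
        .cond (.eq 14 15) (block [.load 16 5 13, .load 17 7 12,
          .cond (.eq 16 17) (.store 8 12 28) .skip, .store 7 12 13]) .skip]) rfl ?_).mono
          (by decide) fun _ _ h => h
      simp only [State.setReg_arr]
      convert this using 1
      · by_cases c1 : δ (T j) = δ (H j)
        · simp [eval, block, Test.Holds, State.setReg_reg, State.setArr_arr, hij, b1, b2, b4, c1]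
        · by_cases c2 : δ (T j) + 1 = δ (H j) <;> by_cases c3 : mate (H j) = τ.arr 7 (T j) <;>
          simp [eval, block, Test.Holds, State.setReg_reg, State.setArr_arr, hij, b1, b2, b4, b5,
            c1, c2, c3]
      · by_cases c1 : δ (T j) = δ (H j)
        · simp [eval, block, Test.Holds, State.setReg_reg, State.setArr_arr, hij, b1, b2, b4, c1]
        · by_cases c2 : δ (T j) + 1 = δ (H j) <;> by_cases c3 : mate (H j) = τ.arr 7 (T j) <;>
          simp [eval, block, Test.Holds, State.setReg_reg, State.setArr_arr, hij, b1, b2, b4, b5,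
            c1, c2, c3]
      · by_cases c1 : δ (T j) = δ (H j)
        · simp [eval, block, Test.Holds, State.setReg_reg, State.setArr_arr, hij, b1, b2, b4, c1]
        · by_cases c2 : δ (T j) + 1 = δ (H j) <;> by_cases c3 : mate (H j) = τ.arr 7 (T j) <;>
          simp [eval, block, Test.Holds, State.setReg_reg, State.setArr_arr, hij, b1, b2, b4, b5,
            b28, c1, c2, c3]

end RAM

namespace RAM

open Prog

/-! ### The whole program -/

/-- Compute the tables and search. -/
def analyse : Prog := block [distTable, negTable, backTable, mateTable, litTable, search]

-- Width and number of backward arcs are assumed for every correct distance table, because the table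
-- itself is only produced during the run.
open scoped Classical in
theorem analyse_spec {n s t m q K Z : ℕ} {r : ℕ → ℕ → Prop} {σ : State}
    (hr : EdgeRel m (σ.arr 1) (σ.arr 2) = r)
    (hn : σ.reg 20 = n) (hs : σ.reg 21 = s) (ht : σ.reg 22 = t) (hm : σ.reg 23 = m)
    (hq : σ.reg 24 = q) (h0 : σ.reg 0 = 0) (h27 : σ.reg 27 = 0) (h29 : σ.reg 29 = 0)
    (h11 : ∀ i, σ.arr 11 i = 0) (hsn : s < n)
    (hlt : ∀ j < m, σ.arr 1 j < n ∧ σ.arr 2 j < n)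
    (hpair : ∀ i < q, σ.arr 13 i < n ∧ σ.arr 14 i < n)
    (hacyc : ∀ v, ¬ Relation.TransGen r v v)
    (hwidth : ∀ δ, IsDist r n s δ → ∀ a < n, ∀ b < n, ∀ c < n, δ a < n → δ a = δ b → δ a = δ c →
      a = b ∨ a = c ∨ b = c)
    (hK : ∀ δ, IsDist r n s δ →
      ((Finset.range m).filter (IsBack n δ (σ.arr 1) (σ.arr 2))).card ≤ K)
    (hZ : 8 * (n + m + q) ≤ Z) :
    Wp analyse (2 ^ K * (300 * Z ^ 4)) σ fun τ => τ.reg 0 =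
      if ∃ p : List ℕ, IsDirPath ⟨r⟩ s t p ∧ ∀ i < q, ¬ (σ.arr 13 i ∈ p ∧ σ.arr 14 i ∈ p)
      then 1 else 0 := by
  have hZ1 : 1 ≤ Z := by omega
  have hrlt : ∀ a b, r a b → a < n ∧ b < n := by
    rw [← hr]
    rintro a b ⟨j, hj, rfl, rfl⟩
    exact hlt j hj
  refine (Wp.seq (distTable_spec hn hm hs hsn hlt (show n ≤ Z by omega) (show m ≤ Z by omega))
    (C := (2 + (2 + n * (3 + 2))) + ((1 + (2 + m * (11 + 2))) + (19 * Z ^ 2 +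
      (((2 + n * (5 + 2)) + (2 + m * (16 + 2))) + 2 ^ K * (170 * Z ^ 4))))) ?_).mono ?_
    fun _ _ h => h
  swap
  · have h1 : 1 ≤ 2 ^ K := Nat.one_le_two_pow
    have h2 : Z ≤ Z ^ 4 := Nat.le_self_pow (by decide) Z
    have h3 : Z ^ 2 ≤ Z ^ 4 := Nat.pow_le_pow_right hZ1 (by decide)
    have h4 : Z ^ 4 ≤ 2 ^ K * Z ^ 4 := Nat.le_mul_of_pos_left _ h1
    rw [mul_left_comm (2 ^ K), mul_left_comm (2 ^ K)]
    omega
  intro τ₁ f₁ d₁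
  rw [hr] at d₁
  have hstep : ∀ a b, r a b → τ₁.arr 4 a < n → τ₁.arr 4 b < n ∧ τ₁.arr 4 b ≤ τ₁.arr 4 a + 1 := by
    intro a b hab ha
    obtain ⟨han, hbn⟩ := hrlt a b hab
    have hlt : ∀ {v}, v < n → (τ₁.arr 4 v < n ↔ Relation.ReflTransGen r s v) := fun h =>
      d₁.lt_iff (fun a b h => (hrlt a b h).2) hsn h
    refine ⟨(hlt hbn).2 (((hlt han).1 ha).tail hab), ?_⟩
    exact d₁.min b hbn _ ⟨a, d₁.walk a han ha, hab⟩
  refine Wp.seq (negTable_spec (n := n) (by rw [f₁.reg 20, hn])) ?_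
  rintro τ₂ f₂ ⟨one₂, nn₂, neg₂⟩
  refine Wp.seq (backTable_spec (n := n) (m := m) (by rw [f₂.reg 20, f₁.reg 20, hn])
    (by rw [f₂.reg 23, f₁.reg 23, hm]) (by rw [f₂.arr 1, f₁.arr 1])
    (by rw [f₂.arr 2, f₁.arr 2]) (f₂.arr 4)) ?_
  rintro τ₃ f₃ ⟨k₃, back₃, back₃'⟩
  have a4 : τ₃.arr 4 = τ₁.arr 4 := by rw [f₃.arr 4, f₂.arr 4]
  refine Wp.seq (mateTable_spec (n := n) (δ := τ₁.arr 4)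
    (by rw [f₃.reg 20, f₂.reg 20, f₁.reg 20, hn]) a4 (show n ≤ Z by omega) hZ1) ?_
  intro τ₄ f₄ mate₄
  have hmate : ∀ v < n, τ₁.arr 4 v < n → τ₄.arr 5 v < n ∧
      ∀ u < n, τ₁.arr 4 u = τ₁.arr 4 v → u = v ∨ u = τ₄.arr 5 v := by
    intro v hv hd
    obtain ⟨m1, m2, m3⟩ := mate₄ v hv
    refine ⟨m1, fun u hu hud => ?_⟩
    by_contra! hne
    have h1 := m3 u hu hud hne.1
    rcases hwidth _ d₁ v hv u hu _ m1 hd hud.symm m2.symm with e | e | e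
    · exact hne.1 e.symm
    · exact h1 e.symm
    · exact hne.2 e
  have hback : ∀ j < m, τ₁.arr 4 (σ.arr 1 j) < n → τ₁.arr 4 (σ.arr 2 j) < n := fun j hj h =>
    (hstep _ _ (by rw [← hr]; exact ⟨j, hj, rfl, rfl⟩) h).1
  refine Wp.seq (litTable_spec (n := n) (m := m) (δ := τ₁.arr 4) (T := σ.arr 1) (H := σ.arr 2)
    (mate := τ₄.arr 5) (by rw [f₄.reg 20, f₃.reg 20, f₂.reg 20, f₁.reg 20, hn])
    (by rw [f₄.reg 23, f₃.reg 23, f₂.reg 23, f₁.reg 23, hm])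
    (by rw [f₄.reg 28, f₃.reg 28, one₂]) (by rw [f₄.arr 1, f₃.arr 1, f₂.arr 1, f₁.arr 1])
    (by rw [f₄.arr 2, f₃.arr 2, f₂.arr 2, f₁.arr 2]) (by rw [f₄.arr 4, a4]) rfl
    (by rw [f₄.arr 15, f₃.arr 15]; exact neg₂) hlt hback hmate) ?_
  intro τ₅ f₅ lits₅
  rw [LitsUpTo, hr] at lits₅
  have hedge : ∀ {v w}, r v w → ∃ i < m, σ.arr 1 i = v ∧ σ.arr 2 i = w := by
    intro v w h; rw [← hr] at h; exact h
  -- The abstract tables are the memory contents just before the search, so most of `Env` holds by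
  -- definition.
  let c : Tables := ⟨n, s, t, q, τ₅.reg 25, τ₅.arr 4, τ₅.arr 5, τ₅.arr 6, τ₅.arr 7, τ₅.arr 8,
    τ₅.arr 9, τ₅.arr 10, τ₅.arr 13, τ₅.arr 14⟩
  have r25 : τ₅.reg 25 = τ₃.reg 25 := by rw [f₅.reg 25, f₄.reg 25]
  have b4 : τ₅.arr 4 = τ₁.arr 4 := by rw [f₅.arr 4, f₄.arr 4, a4]
  have b5 : τ₅.arr 5 = τ₄.arr 5 := f₅.arr 5
  have b9 : τ₅.arr 9 = τ₃.arr 9 := by rw [f₅.arr 9, f₄.arr 9]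
  have b10 : τ₅.arr 10 = τ₃.arr 10 := by rw [f₅.arr 10, f₄.arr 10]
  have b13 : τ₅.arr 13 = σ.arr 13 := by
    rw [f₅.arr 13, f₄.arr 13, f₃.arr 13, f₂.arr 13, f₁.arr 13]
  have b14 : τ₅.arr 14 = σ.arr 14 := by
    rw [f₅.arr 14, f₄.arr 14, f₃.arr 14, f₂.arr 14, f₁.arr 14]
  have hc : c.Correct r := by
    refine ⟨hsn, hrlt, hacyc, ?_, ?_, ?_, ?_, ?_, ?_, ?_, ?_, ?_, ?_, ?_⟩ <;>
      simp only [c, b4, b5]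
    · exact Nat.le_zero.1 (d₁.min s hsn 0 rfl)
    · exact hstep
    · exact fun v hv hd => ⟨(mate₄ v hv).1, (mate₄ v hv).2.1, (hmate v hv hd).2⟩
    · intro v hv hd
      refine (lits₅ v hv hd).1.imp (fun k => ⟨k.1, fun w hw => ?_⟩) id
      obtain ⟨i, hi, e1, rfl⟩ := hedge hw
      exact k.2 i hi e1
    · intro v hv hd
      refine (lits₅ v hv hd).2.1.imp (fun k => ⟨k.1, fun w hw => ?_⟩) id
      obtain ⟨i, hi, e1, rfl⟩ := hedge hw
      exact k.2 i hi e1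
    · intro v hv hd hz w hw
      obtain ⟨i, hi, e1, rfl⟩ := hedge hw
      exact (lits₅ v hv hd).2.2.1 hz i hi e1
    · exact fun v hv hd => (lits₅ v hv hd).2.2.2
    · intro i hi
      obtain ⟨j, hj, e1, e2⟩ := back₃ i (by omega)
      rw [b9, b10, e1, e2, ← hr]
      exact ⟨j, hj, rfl, rfl⟩
    · intro a b hab ha hba
      obtain ⟨j, hj, rfl, rfl⟩ := hedge hab
      obtain ⟨i, hi, e⟩ := back₃' j hj ⟨ha, hba⟩
      exact ⟨i, by omega, by rw [b9, b10]; exact e⟩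
    · rw [b13]; exact fun i hi => (hpair i hi).1
    · rw [b14]; exact fun i hi => (hpair i hi).2
  have he : Env c τ₅ := by
    refine ⟨?_, ?_, ?_, ?_, rfl, ?_, ?_, ?_, rfl, rfl, rfl, rfl, rfl, rfl, rfl, rfl, rfl, ?_⟩
    · rw [f₅.reg 20, f₄.reg 20, f₃.reg 20, f₂.reg 20, f₁.reg 20, hn]
    · rw [f₅.reg 21, f₄.reg 21, f₃.reg 21, f₂.reg 21, f₁.reg 21, hs]
    · rw [f₅.reg 22, f₄.reg 22, f₃.reg 22, f₂.reg 22, f₁.reg 22, ht]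
    · rw [f₅.reg 24, f₄.reg 24, f₃.reg 24, f₂.reg 24, f₁.reg 24, hq]
    · rw [f₅.reg 26, f₄.reg 26, f₃.reg 26, nn₂]
    · rw [f₅.reg 27, f₄.reg 27, f₃.reg 27, f₂.reg 27, f₁.reg 27, h27]
    · rw [f₅.reg 28, f₄.reg 28, f₃.reg 28, one₂]
    · rw [f₅.arr 15, f₄.arr 15, f₃.arr 15]; exact neg₂
  have hkK : c.k ≤ K := by
    simp only [c, r25, k₃]
    exact hK _ d₁
  have hkm : c.k ≤ m := by
    simp only [c, r25, k₃]
    exact (Finset.card_filter_le _ _).trans (Finset.card_range m).le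
  refine (search_spec hc he (Z := Z) (by simp only [c] at hkm ⊢; omega) ?_ ?_ ?_).mono ?_ ?_
  · rw [f₅.reg 0, f₄.reg 0, f₃.reg 0, f₂.reg 0, f₁.reg 0, h0]
  · rw [f₅.reg 29, f₄.reg 29, f₃.reg 29, f₂.reg 29, f₁.reg 29, h29]
  · intro i _
    rw [f₅.arr 11, f₄.arr 11, f₃.arr 11, f₂.arr 11, f₁.arr 11, h11]
  · exact Nat.mul_le_mul_right _ (Nat.pow_le_pow_right (by decide) hkK)
  · intro τ₆ _ h₆
    rw [h₆]
    refine if_congr ?_ rfl rfl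
    simp only [Tables.Safe, c, b13, b14]

/-! ### Parsing the input word -/

/-- Read as many pairs of numbers as register `c` says from the input to the arrays `a`, `b`. -/
def readPairs (c a b : ℕ) : Prog :=
  forLoop 11 c (block [.load 12 0 10, .store a 11 12, .succ 10, .load 12 0 10, .store b 11 12,
    .succ 10])

/-- Read the input. -/
def parse : Prog :=
  block [block [.load 20 0 10, .succ 10, .load 21 0 10, .succ 10, .load 22 0 10, .succ 10,
    .load 23 0 10, .succ 10], readPairs 23 1 2, block [.load 24 0 10, .succ 10],
    readPairs 24 13 14]

theorem readPairs_spec {c a b o N : ℕ} {A B : ℕ → ℕ} {σ : State} (hN : σ.reg c = N)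
    (ho : σ.reg 10 = o) (ha : a ≠ 0) (hb : b ≠ 0) (hab : a ≠ b) (h10 : c ≠ 10) (h11 : c ≠ 11)
    (h12 : c ≠ 12)
    (h : ∀ j < N, σ.arr 0 (o + 2 * j) = A j ∧ σ.arr 0 (o + 2 * j + 1) = B j) :
    Wp (readPairs c a b) (2 + N * (6 + 2)) σ fun τ => τ.reg 10 = o + 2 * N ∧
      ∀ j < N, τ.arr a j = A j ∧ τ.arr b j = B j := by
  refine Wp.forLoop (fun j τ => τ.reg 10 = o + 2 * j ∧
    ∀ i < j, τ.arr a i = A i ∧ τ.arr b i = B i) hN rfl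
    (by simp [wr, block, h10, h12]) h11 (by simp [State.setReg_reg, ho]) ?_
  rintro j hj τ hf hij ⟨h1, h2⟩
  refine Wp.of_loopFree rfl ?_
  have h0 : τ.arr 0 = σ.arr 0 := hf.arr 0 (by simp [wa, block, forLoop, ha.symm, hb.symm])
  obtain ⟨q1, q2⟩ := h j hj
  have ha' : (0 : ℕ) ≠ a := ha.symm
  simp only [eval, block, State.setReg_arr, State.setArr_arr, State.setReg_reg, hij, h0,
    State.setArr_reg, h1, if_neg hab, if_neg hab.symm, if_neg ha', q1]
  refine ⟨by simp; omega, fun i hi => ?_⟩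
  by_cases hij' : i = j
  · subst hij'; simp [q2]
  · simpa [hij'] using h2 i (by omega)

/-- The word of a list of pairs. -/
def pairWord (L : List (ℕ × ℕ)) : List ℕ := L.flatMap fun a => [a.1, a.2]

theorem pairWord_getD (L : List (ℕ × ℕ)) (R : List ℕ) (j : ℕ) (hj : j < L.length) :
    (pairWord L ++ R).getD (2 * j) 0 = (L.getD j (0, 0)).1 ∧
      (pairWord L ++ R).getD (2 * j + 1) 0 = (L.getD j (0, 0)).2 := by
  induction L generalizing j with
  | nil => simp at hj
  | cons a L ih =>
    cases j with
    | zero => simp [pairWord]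
    | succ j =>
      have := ih j (by simpa using hj)
      simpa [pairWord, Nat.mul_succ] using this

theorem pairWord_getD_length (L : List (ℕ × ℕ)) (R : List ℕ) (i : ℕ) :
    (pairWord L ++ R).getD (2 * L.length + i) 0 = R.getD i 0 := by
  induction L with
  | nil => simp [pairWord]
  | cons a L ih =>
    rw [← ih, List.length_cons, show 2 * (L.length + 1) + i = 2 * L.length + i + 1 + 1 by ring]
    simp [pairWord]

theorem parse_spec {n s t : ℕ} {L P : List (ℕ × ℕ)} {w : List ℕ}
    (hw : w = [n, s, t, L.length] ++ pairWord L ++ [P.length] ++ pairWord P) :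
    Wp parse (8 + ((2 + L.length * (6 + 2)) + (2 + (2 + P.length * (6 + 2))))) (initState w)
      fun τ => τ.reg 20 = n ∧ τ.reg 21 = s ∧ τ.reg 22 = t ∧ τ.reg 23 = L.length ∧
        τ.reg 24 = P.length ∧
        (∀ j < L.length, τ.arr 1 j = (L.getD j (0, 0)).1 ∧ τ.arr 2 j = (L.getD j (0, 0)).2) ∧
        ∀ j < P.length, τ.arr 13 j = (P.getD j (0, 0)).1 ∧ τ.arr 14 j = (P.getD j (0, 0)).2 := by
  -- The trailing `[]` gives the last list of pairs the same shape as the first, a pair word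
  -- followed by a rest.
  have hw' : w = n :: s :: t :: L.length :: (pairWord L ++ (P.length :: (pairWord P ++ []))) := by
    simp [hw]
  have w0 : (initState w).arr 0 = fun i => w.getD i 0 := by funext i; simp [initState]
  have wL : ∀ i, w.getD (4 + i) 0 = (pairWord L ++ (P.length :: (pairWord P ++ []))).getD i 0 := by
    intro i
    rw [hw', show 4 + i = i + 1 + 1 + 1 + 1 by ring]
    simp only [List.getD_cons_succ]
  have wP : ∀ i, w.getD (4 + 2 * L.length + 1 + i) 0 = (pairWord P ++ []).getD i 0 := by
    intro i
    rw [add_assoc, add_assoc, wL, ← add_assoc, add_assoc, pairWord_getD_length, add_comm 1 i,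
      List.getD_cons_succ]
  have g0 : w.getD 0 0 = n := by simp [hw']
  have g1 : w.getD 1 0 = s := by simp [hw']
  have g2 : w.getD 2 0 = t := by simp [hw']
  have g3 : w.getD 3 0 = L.length := by simp [hw']
  have g4 : w.getD (4 + 2 * L.length) 0 = P.length := by
    have := pairWord_getD_length L (P.length :: (pairWord P ++ [])) 0
    rw [add_zero] at this
    rw [wL, this]
    rfl
  refine Wp.seq_eval rfl fun τ₁ e₁ f₁ => ?_
  have z : ∀ x, (initState w).reg x = 0 := fun _ => rfl
  have r20 : τ₁.reg 20 = n := by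
    simp only [e₁, eval, block, State.setReg_reg, State.setReg_arr, w0, z]; simpa using g0
  have r21 : τ₁.reg 21 = s := by
    simp only [e₁, eval, block, State.setReg_reg, State.setReg_arr, w0, z]; simpa using g1
  have r22 : τ₁.reg 22 = t := by
    simp only [e₁, eval, block, State.setReg_reg, State.setReg_arr, w0, z]; simpa using g2
  have r23 : τ₁.reg 23 = L.length := by
    simp only [e₁, eval, block, State.setReg_reg, State.setReg_arr, w0, z]; simpa using g3
  have r10 : τ₁.reg 10 = 4 := by
    simp [e₁, eval, block, State.setReg_reg, z]
  have a0 : τ₁.arr 0 = fun i => w.getD i 0 := by rw [f₁.arr 0, w0]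
  refine Wp.seq (readPairs_spec (o := 4) (A := fun j => (L.getD j (0, 0)).1)
    (B := fun j => (L.getD j (0, 0)).2) r23 r10 (by decide) (by decide) (by decide) (by decide)
    (by decide) (by decide) ?_) ?_
  · intro j hj
    rw [a0]
    simp only [add_assoc, wL]
    exact pairWord_getD L _ j hj
  rintro τ₂ f₂ ⟨p₂, l₂⟩
  have b0 : τ₂.arr 0 = fun i => w.getD i 0 := by rw [f₂.arr 0, a0]
  refine Wp.seq_eval rfl fun τ₃ e₃ f₃ => ?_
  have s24 : τ₃.reg 24 = P.length := by
    simp only [e₃, eval, block, State.setReg_reg, b0, p₂]; simpa using g4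
  have s10 : τ₃.reg 10 = 4 + 2 * L.length + 1 := by
    simp [e₃, eval, block, State.setReg_reg, p₂]
  refine (readPairs_spec (o := 4 + 2 * L.length + 1) (A := fun j => (P.getD j (0, 0)).1)
    (B := fun j => (P.getD j (0, 0)).2) s24 s10 (by decide) (by decide) (by decide) (by decide)
    (by decide) (by decide) ?_).mono le_rfl ?_
  · intro j hj
    rw [f₃.arr 0, b0]
    simp only [add_assoc (4 + 2 * L.length + 1), wP]
    exact pairWord_getD P _ j hj
  · rintro τ₄ f₄ ⟨-, l₄⟩
    refine ⟨?_, ?_, ?_, ?_, ?_, ?_, l₄⟩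
    · rw [f₄.reg 20, f₃.reg 20, f₂.reg 20, r20]
    · rw [f₄.reg 21, f₃.reg 21, f₂.reg 21, r21]
    · rw [f₄.reg 22, f₃.reg 22, f₂.reg 22, r22]
    · rw [f₄.reg 23, f₃.reg 23, f₂.reg 23, r23]
    · rw [f₄.reg 24, s24]
    · rw [f₄.arr 1, f₄.arr 2, f₃.arr 1, f₃.arr 2]; exact l₂

end RAM

/-! ### Descriptions of instances -/

namespace PAFPInstance

open RAM

section Coding

variable {V : Type*} {I : PAFPInstance V} {n : ℕ} (e : V ≃ Fin n) {r : ℕ → ℕ → Prop}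

/-- The relation `r` is the adjacency relation of the instance after numbering the vertices. -/
def IsCoded (I : PAFPInstance V) (e : V ≃ Fin n) (r : ℕ → ℕ → Prop) : Prop :=
  ∀ a b, r a b ↔ ∃ u v, I.G.Adj u v ∧ (e u : ℕ) = a ∧ (e v : ℕ) = b

variable {e}

theorem coded_inj {u v : V} (h : (e u : ℕ) = e v) : u = v := e.injective (Fin.ext h)

theorem IsCoded.adj (hr : IsCoded I e r) {u v : V} : r (e u) (e v) ↔ I.G.Adj u v := by
  rw [hr]
  constructor
  · rintro ⟨u', v', h, h1, h2⟩
    rwa [← coded_inj h1, ← coded_inj h2]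
  · exact fun h => ⟨u, v, h, rfl, rfl⟩

theorem IsCoded.walkFrom_iff (hr : IsCoded I e r) {s v : V} {k : ℕ} :
    WalkFrom r (e s) k (e v) ↔ WalkFrom I.G.Adj s k v := by
  induction k generalizing v with
  | zero => exact ⟨fun h => coded_inj h, fun h => congrArg (fun v => (e v : ℕ)) h⟩
  | succ k ih =>
    constructor
    · rintro ⟨a, ha, hav⟩
      obtain ⟨u, v', huv, rfl, h2⟩ := (hr _ _).1 hav
      exact ⟨u, ih.1 ha, coded_inj h2 ▸ huv⟩
    · rintro ⟨u, hu, huv⟩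
      exact ⟨e u, ih.2 hu, hr.adj.2 huv⟩

theorem IsCoded.acyclic (hr : IsCoded I e r) (h : IsDAG I.G) (a : ℕ) :
    ¬ Relation.TransGen r a a := by
  have key : ∀ a b, Relation.TransGen r a b →
      ∃ u v, (e u : ℕ) = a ∧ (e v : ℕ) = b ∧ Relation.TransGen I.G.Adj u v := by
    intro a b hab
    induction hab with
    | single h =>
      obtain ⟨u, v, huv, h1, h2⟩ := (hr _ _).1 h
      exact ⟨u, v, h1, h2, .single huv⟩
    | tail _ h ih =>
      obtain ⟨u, v, h1, h2, h3⟩ := ih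
      obtain ⟨v', w, hvw, h4, h5⟩ := (hr _ _).1 h
      obtain rfl : v' = v := coded_inj (h4.trans h2.symm)
      exact ⟨u, w, h1, h5, h3.tail hvw⟩
  intro ha
  obtain ⟨u, v, h1, h2, h3⟩ := key a a ha
  obtain rfl : u = v := coded_inj (h1.trans h2.symm)
  exact h u h3

/-- The numbering carries walks to walks of equal length, so a table computed on numbers gives true
distances in the instance. -/
theorem IsCoded.dirDist_eq (hr : IsCoded I e r) {δ : ℕ → ℕ} {s v : V}
    (hδ : IsDist r n (e s) δ) (hv : δ (e v) < n) : dirDist I.G s v = δ (e v) :=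
  dirDist_eq_of_walk (hr.walkFrom_iff.1 (hδ.walk _ (e v).2 hv)) fun k hk =>
    hδ.min _ (e v).2 k (hr.walkFrom_iff.2 hk)

/-- Three distinct vertices with the same finite table value would form a BFS layer of size at least
three. -/
theorem IsCoded.eq_of_level (hr : IsCoded I e r) (hw : bfsWidth I.G I.s ≤ 2) {δ : ℕ → ℕ}
    (hδ : IsDist r n (e I.s) δ) {a b c : ℕ} (ha : a < n) (hb : b < n) (hc : c < n)
    (hlt : δ a < n) (hab : δ a = δ b) (hac : δ a = δ c) : a = b ∨ a = c ∨ b = c := by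
  obtain ⟨u, hu⟩ := e.surjective ⟨a, ha⟩
  obtain ⟨v, hv⟩ := e.surjective ⟨b, hb⟩
  obtain ⟨w, hw'⟩ := e.surjective ⟨c, hc⟩
  obtain rfl : (e u : ℕ) = a := by rw [hu]
  obtain rfl : (e v : ℕ) = b := by rw [hv]
  obtain rfl : (e w : ℕ) = c := by rw [hw']
  by_contra! hne
  obtain ⟨h1, h2, h3⟩ := hne
  have hsub : ({u, v, w} : Set V) ⊆ bfsLayer I.G I.s (δ (e u)) := by
    rintro x (rfl | rfl | rfl)
    · exact hr.dirDist_eq hδ hlt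
    · rw [hab]; exact hr.dirDist_eq hδ (hab ▸ hlt)
    · rw [hac]; exact hr.dirDist_eq hδ (hac ▸ hlt)
  have h3' : ({u, v, w} : Set V).encard = 3 :=
    Set.encard_eq_three.2 ⟨u, v, w, fun h => h1 (by rw [h]), fun h => h2 (by rw [h]),
      fun h => h3 (by rw [h]), rfl⟩
  have := (Set.encard_le_encard hsub).trans ((le_iSup (fun d => (bfsLayer I.G I.s d).encard)
    (δ (e u))).trans hw)
  rw [h3'] at this
  exact absurd this (by decide)

-- Each index counted is sent to the arc listed there, which is backward in the instance; this is
-- injective because the list has no repetitions. The default value of `getD` is never reached.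
open scoped Classical in
theorem IsCoded.card_back_le [Finite V] (hr : IsCoded I e r) {arcs : List (V × V)}
    (hnd : arcs.Nodup) (harcs : ∀ a, a ∈ arcs ↔ a ∈ arcSet I.G) {δ T H : ℕ → ℕ}
    (hδ : IsDist r n (e I.s) δ)
    (hT : ∀ j (hj : j < arcs.length), T j = e arcs[j].1 ∧ H j = e arcs[j].2) :
    ((Finset.range arcs.length).filter (IsBack n δ T H)).card ≤ I.numBackward := by
  have hfin : (backwardArcs I.G I.s).Finite := Set.toFinite _
  rw [numBackward, Set.ncard_eq_toFinset_card _ hfin]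
  refine Finset.card_le_card_of_injOn (fun j => arcs.getD j (I.s, I.s)) ?_ ?_
  · intro j hj
    simp only [Finset.coe_filter, Finset.mem_range, Set.mem_ofPred_eq, IsBack] at hj
    obtain ⟨hj, h1, h2⟩ := hj
    rw [(hT j hj).1] at h1 h2
    rw [(hT j hj).2] at h2
    have d1 := hr.dirDist_eq hδ h1
    have d2 := hr.dirDist_eq hδ (h2.trans h1)
    simp only [List.getD_eq_getElem _ _ hj, Set.Finite.coe_toFinset]
    refine ⟨(harcs _).1 (List.getElem_mem hj), ?_, ?_, ?_⟩
    · rw [d1]; exact ENat.natCast_lt_top _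
    · rw [d2]; exact ENat.natCast_lt_top _
    · rw [d1, d2]; exact_mod_cast h2
  · intro i hi j hj hij
    simp only [Finset.coe_filter, Finset.mem_range, Set.mem_ofPred_eq] at hi hj
    simp only [List.getD_eq_getElem _ _ hi.1, List.getD_eq_getElem _ _ hj.1] at hij
    exact (hnd.getElem_inj_iff).1 hij

theorem IsCoded.safe_iff (hr : IsCoded I e r) {pairs : List (V × V)}
    (hpairs : ∀ q, q ∈ (pairs.map fun q => s(q.1, q.2)) ↔ q ∈ I.F) {A B : ℕ → ℕ}
    (hA : ∀ j (hj : j < pairs.length), A j = e pairs[j].1 ∧ B j = e pairs[j].2) :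
    (∃ p : List ℕ, IsDirPath ⟨r⟩ (e I.s) (e I.t) p ∧
      ∀ i < pairs.length, ¬ (A i ∈ p ∧ B i ∈ p)) ↔ I.HasSafePath := by
  have hmap : ∀ (p : List V) (u : V), (e u : ℕ) ∈ p.map (fun v => (e v : ℕ)) ↔ u ∈ p := by
    intro p u
    rw [List.mem_map]
    exact ⟨fun ⟨v, hv, h⟩ => coded_inj h ▸ hv, fun h => ⟨u, h, rfl⟩⟩
  have hpath : ∀ p : List V, IsDirPath ⟨r⟩ (e I.s) (e I.t) (p.map fun v => (e v : ℕ)) ↔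
      IsDirPath I.G I.s I.t p := by
    intro p
    have hinj : Function.Injective fun v => (e v : ℕ) := fun _ _ h => coded_inj h
    have hopt : ∀ (o : Option V) (u : V), o.map (fun v => (e v : ℕ)) = some ↑(e u) ↔ o = some u :=
      fun o u => by
        cases o with
        | none => simp
        | some v => exact ⟨fun h => by rw [coded_inj (Option.some.inj h)], fun h => by rw [h]; rfl⟩
    constructor
    · rintro ⟨h1, h2, h3, h4⟩
      rw [List.isChain_map] at h1
      rw [List.head?_map, hopt] at h3
      rw [List.getLast?_map, hopt] at h4
      exact ⟨h1.imp fun _ _ h => hr.adj.1 h, h2.of_map _, h3, h4⟩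
    · rintro ⟨h1, h2, h3, h4⟩
      refine ⟨?_, h2.map hinj, ?_, ?_⟩
      · rw [List.isChain_map]; exact h1.imp fun _ _ h => hr.adj.2 h
      · rw [List.head?_map, hopt]; exact h3
      · rw [List.getLast?_map, hopt]; exact h4
  have hsafe : ∀ p : List V, (∀ i < pairs.length, ¬ (A i ∈ p.map (fun v => (e v : ℕ)) ∧
      B i ∈ p.map fun v => (e v : ℕ))) ↔ ∀ a b : V, s(a, b) ∈ I.F → ¬ (a ∈ p ∧ b ∈ p) := by
    intro p
    constructor
    · intro h a b hab ⟨ha, hb⟩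
      obtain ⟨q, hq, hqab⟩ := List.mem_map.1 ((hpairs _).2 hab)
      obtain ⟨i, hi, rfl⟩ := List.getElem_of_mem hq
      have := h i hi
      rw [(hA i hi).1, (hA i hi).2, hmap, hmap] at this
      -- A forbidden pair may be listed in either order.
      rcases Sym2.eq_iff.1 hqab with ⟨h1, h2⟩ | ⟨h1, h2⟩
      · exact this ⟨h1 ▸ ha, h2 ▸ hb⟩
      · exact this ⟨h1 ▸ hb, h2 ▸ ha⟩
    · intro h i hi
      rw [(hA i hi).1, (hA i hi).2, hmap, hmap]
      exact h _ _ ((hpairs _).1 (List.mem_map.2 ⟨_, List.getElem_mem hi, rfl⟩))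
  constructor
  · rintro ⟨p, hp, hF⟩
    -- Every number on the path is the code of a vertex: the start is, and so is the head of each
    -- arc. Hence the path lifts to the instance.
    have hlt : ∀ v ∈ p, ∃ u, (e u : ℕ) = v :=
      forall_mem_of_isChain (P := fun v => ∃ u, (e u : ℕ) = v)
        (fun a b hab _ => by obtain ⟨_, v, -, -, h⟩ := (hr a b).1 hab; exact ⟨v, h⟩)
        hp.chain hp.head ⟨I.s, rfl⟩
    obtain ⟨p', rfl⟩ : ∃ p' : List V, p'.map (fun v => (e v : ℕ)) = p := by
      have : p ∈ Set.range (List.map fun v => (e v : ℕ)) := by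
        rw [Set.range_list_map]
        exact hlt
      exact this
    exact ⟨p', (hpath p').1 hp, (hsafe p').1 hF⟩
  · rintro ⟨p, hp, hF⟩
    exact ⟨_, (hpath p).2 hp, (hsafe p).2 hF⟩

end Coding

/-- With a base of at least two, constant factors, and `2 ^ k` for fixed `k`, are absorbed into the
exponent of the size. -/
theorem two_le_size {V : Type*} [Finite V] (I : PAFPInstance V) : 2 ≤ I.size := by
  have : 1 < Nat.card V := by
    rw [Finite.one_lt_card_iff_nontrivial]
    exact ⟨I.s, I.t, I.s_ne_t⟩
  unfold size
  omega

end PAFPInstance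

/-! ### The complete procedure and its running time -/

namespace RAM

/-- The decision procedure. -/
def decidePAFP : Prog := .seq parse analyse

theorem decidePAFP_spec {V : Type*} [Finite V] (I : PAFPInstance V) (hdag : IsDAG I.G)
    (hwidth : bfsWidth I.G I.s ≤ 2) {w : List ℕ} (hw : I.IsEncoding w) :
    DecidesWithin decidePAFP w I.HasSafePath (2 ^ I.numBackward * I.size ^ 25) := by
  classical
  obtain ⟨e, arcs, pairs, hand, harcs, hpnd, hpairs, hw⟩ := hw
  have hm : arcs.length = (arcSet I.G).ncard := by
    rw [← List.toFinset_card_of_nodup hand, ← Set.ncard_coe_finset]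
    congr 1; ext a; simp [harcs]
  have hq : pairs.length = I.F.ncard := by
    rw [← List.length_map (as := pairs) (fun q => s(q.1, q.2)), ← List.toFinset_card_of_nodup hpnd,
      ← Set.ncard_coe_finset]
    congr 1; ext a
    rw [Finset.mem_coe, List.mem_toFinset, hpairs]
  have hsize : I.size = Nat.card V + arcs.length + pairs.length := by
    rw [PAFPInstance.size, hm, hq]
  have hs2 := I.two_le_size
  set f : V × V → ℕ × ℕ := fun a => ((e a.1 : ℕ), (e a.2 : ℕ)) with hf
  have hword : w =
      [Nat.card V, (e I.s : ℕ), (e I.t : ℕ), (arcs.map f).length] ++ pairWord (arcs.map f) ++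
        [(pairs.map f).length] ++ pairWord (pairs.map f) := by
    simp [hw, pairWord, List.flatMap_map, hf]
  have hget : ∀ (l : List (V × V)) (j) (hj : j < l.length),
      ((l.map f).getD j (0, 0)).1 = e l[j].1 ∧ ((l.map f).getD j (0, 0)).2 = e l[j].2 := by
    intro l j hj
    rw [List.getD_eq_getElem _ _ (by simpa using hj), List.getElem_map]
    exact ⟨rfl, rfl⟩
  have hrun : Wp decidePAFP (2 ^ I.numBackward * I.size ^ 25) (initState w) fun τ =>
      τ.reg 0 = if I.HasSafePath then 1 else 0 := by
    refine (Wp.seq (parse_spec hword) (C := 2 ^ I.numBackward * (300 * (8 * I.size) ^ 4)) ?_).mono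
      ?_ fun _ _ h => h
    swap
    · have h1 : 1 ≤ 2 ^ I.numBackward := Nat.one_le_two_pow
      have h2 : I.size ≤ I.size ^ 4 := Nat.le_self_pow (by decide) _
      -- The total constant is `300 * 8 ^ 4 + 30 = 1228830`, which is below `2 ^ 21`; this explains
      -- the exponent `25 = 21 + 4`.
      have h3 : 2 ^ 21 * I.size ^ 4 ≤ I.size ^ 25 := by
        rw [show 25 = 21 + 4 from rfl, pow_add]
        exact Nat.mul_le_mul_right _ (Nat.pow_le_pow_left hs2 21)
      have h4 : 30 * I.size ^ 4 ≤ 2 ^ I.numBackward * (30 * I.size ^ 4) :=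
        Nat.le_mul_of_pos_left _ h1
      rw [List.length_map, List.length_map]
      calc _ ≤ 2 ^ I.numBackward * (30 * I.size ^ 4) +
            2 ^ I.numBackward * (300 * (8 * I.size) ^ 4) := by omega
        _ = 2 ^ I.numBackward * (1228830 * I.size ^ 4) := by ring
        _ ≤ _ := Nat.mul_le_mul_left _ (by omega)
    rintro τ ft ⟨r20, r21, r22, r23, r24, hL, hP⟩
    rw [List.length_map] at r23 r24 hL hP
    have hT : ∀ j (hj : j < arcs.length),
        τ.arr 1 j = e arcs[j].1 ∧ τ.arr 2 j = e arcs[j].2 := fun j hj => by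
      rw [(hL j hj).1, (hL j hj).2]; exact hget arcs j hj
    have hA : ∀ j (hj : j < pairs.length),
        τ.arr 13 j = e pairs[j].1 ∧ τ.arr 14 j = e pairs[j].2 := fun j hj => by
      rw [(hP j hj).1, (hP j hj).2]; exact hget pairs j hj
    have hr : I.IsCoded e (EdgeRel arcs.length (τ.arr 1) (τ.arr 2)) := by
      intro a b
      constructor
      · rintro ⟨j, hj, rfl, rfl⟩
        exact ⟨_, _, (harcs _).1 (List.getElem_mem hj), (hT j hj).1.symm, (hT j hj).2.symm⟩
      · rintro ⟨u, v, huv, rfl, rfl⟩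
        obtain ⟨j, hj, hjv⟩ := List.getElem_of_mem ((harcs (u, v)).2 huv)
        refine ⟨j, hj, ?_, ?_⟩
        · rw [(hT j hj).1, hjv]
        · rw [(hT j hj).2, hjv]
    refine (analyse_spec (K := I.numBackward) (Z := 8 * I.size) rfl r20 r21 r22 r23 r24
      (by rw [ft.reg 0]; rfl) (by rw [ft.reg 27]; rfl) (by rw [ft.reg 29]; rfl)
      (fun i => by rw [ft.arr 11]; rfl) (e I.s).2 ?_ ?_ (hr.acyclic hdag) ?_ ?_
      (by omega)).mono le_rfl ?_
    · intro j hj; rw [(hT j hj).1, (hT j hj).2]; exact ⟨(e _).2, (e _).2⟩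
    · intro j hj; rw [(hA j hj).1, (hA j hj).2]; exact ⟨(e _).2, (e _).2⟩
    · exact fun δ hδ a ha b hb c hc => hr.eq_of_level hwidth hδ ha hb hc
    · exact fun δ hδ => hr.card_back_le hand harcs hδ hT
    · intro υ _ hυ
      rw [hυ]
      exact if_congr (hr.safe_iff hpairs hA) rfl rfl
  obtain ⟨T, τ, hT, hR, hτ⟩ := hrun
  exact ⟨T, τ, hT, hR, fun h => by rw [hτ, if_pos h], fun h => by rw [hτ, if_neg h]⟩

end RAM

theorem theorem4 :
    (∃ (P : RAM.Prog) (c : ℕ), ∀ (V : Type u) [Finite V] (I : PAFPInstance V),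
      IsDAG I.G → bfsWidth I.G I.s ≤ 2 →
      ∀ w : List ℕ, I.IsEncoding w →
        RAM.DecidesWithin P w I.HasSafePath (2 ^ I.numBackward * I.size ^ c)) ∧
    (∀ k : ℕ, ∃ (P : RAM.Prog) (c : ℕ), ∀ (V : Type u) [Finite V] (I : PAFPInstance V),
      IsDAG I.G → bfsWidth I.G I.s ≤ 2 → I.numBackward ≤ k →
      ∀ w : List ℕ, I.IsEncoding w →
        RAM.DecidesWithin P w I.HasSafePath (I.size ^ c)) := by
  refine ⟨⟨RAM.decidePAFP, 25, fun V _ I hdag hwidth w hw =>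
    RAM.decidePAFP_spec I hdag hwidth hw⟩, fun k => ⟨RAM.decidePAFP, k + 25, ?_⟩⟩
  intro V _ I hdag hwidth hk w hw
  obtain ⟨T, τ, hT, h⟩ := RAM.decidePAFP_spec I hdag hwidth hw
  refine ⟨T, τ, hT.trans ?_, h⟩
  rw [pow_add]
  refine Nat.mul_le_mul_right _ ?_
  -- For fixed `k` the factor `2 ^ k` is at most the `k`-th power of the size, whence the exponent
  -- `k + 25`.
  exact (Nat.pow_le_pow_right (by decide) hk).trans (Nat.pow_le_pow_left I.two_le_size k)
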